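/- For $m\ge 1$ let $V=\mathbb{F}_2^{\,m}$ and let $(b_v)_{v\in V}$ be the standard orthonormal basis of $\mathbb{R}^{2^m}=\mathbb{R}^V=(\mathbb{R}^2)^{\otimes m}$, where $b_{(v_1,\dots,v_m)}=b_{v_1}\otimes\cdots\otimes b_{v_m}$. For $U\subseteq V$ put $\chi_U=\sum_{v\in U}b_v$. Let $L_m$ (respectively $L'_m$) be the $\mathbb{Z}$-lattice spanned by the vectors $2^{\lfloor (m-d+\delta)/2\rfloor}\chi_U$, where $0\le d\le m$ and $U$ ranges over the $d$-dimensional affine subspaces of $V$, with $\delta=1$ for $L_m$ and $\delta=0$ for $L'_m$. Let $M_m=\sqrt2\,L'_m+L_m$ be the balanced Barnes–Wall lattice, a $\mathbb{Z}[\sqrt2]$-lattice in $\mathbb{R}^{2^m}$, and let $\operatorname{Aut}(M_m)=\{g\in O(2^m,\mathbb{R}) : gM_m=M_m\}$. Let $E(1)=\left\langle \begin{pmatrix}0&1\\1&0\end{pmatrix},\begin{pmatrix}1&0\\0&-1\end{pmatrix}\right\rangle\le O(2,\mathbb{R})$, let $E(m)=E(1)^{\otimes m}=\{g_1\otimes\cdots\otimes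 g_m : g_i\in E(1)\}\le O(2^m,\mathbb{R})$, and let the real Clifford group $\mathcal{C}_m$ be the normalizer of $E(m)$ in $O(2^m,\mathbb{R})$. Then, for every $m\ge 1$, $\operatorname{Aut}(M_m)=\mathcal{C}_m$ as subgroups of $O(2^m,\mathbb{R})$; in particular the two groups are isomorphic. -/

import Mathlib

open scoped Matrix

namespace BarnesWall

/-- The vector space `F_2^m`, which indexes the standard basis of `ℝ^(2^m) = ⊗^m (ℝ^2)`. -/
abbrev V (m : ℕ) : Type := Fin m → ZMod 2

/-! ### The extraspecial group and the real Clifford group -/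

/-- The Kronecker product `A 0 ⊗ ⋯ ⊗ A (m-1)` of `2 × 2` matrices; the basis vector
`b_{v 0} ⊗ ⋯ ⊗ b_{v (m-1)}` is indexed by `v`. -/
def tensorMatrix {m : ℕ} (A : Fin m → Matrix (ZMod 2) (ZMod 2) ℝ) :
    Matrix (V m) (V m) ℝ :=
  Matrix.of fun v w => ∏ i, A i (v i) (w i)

theorem tensorMatrix_one {m : ℕ} :
    tensorMatrix (fun _ : Fin m => (1 : Matrix (ZMod 2) (ZMod 2) ℝ)) = 1 := by
  ext v w
  simp only [tensorMatrix, Matrix.of_apply, Matrix.one_apply]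
  by_cases h : v = w
  · subst h
    simp
  · obtain ⟨i, hi⟩ := Function.ne_iff.mp h
    rw [if_neg h]
    exact Finset.prod_eq_zero (Finset.mem_univ i) (if_neg hi)

theorem tensorMatrix_mul {m : ℕ} (A B : Fin m → Matrix (ZMod 2) (ZMod 2) ℝ) :
    tensorMatrix (fun i => A i * B i) = tensorMatrix A * tensorMatrix B := by
  ext v w
  simp only [tensorMatrix, Matrix.of_apply, Matrix.mul_apply]
  rw [Fintype.prod_sum]
  exact Finset.sum_congr rfl fun x _ => Finset.prod_mul_distrib

theorem tensorMatrix_transpose {m : ℕ} (A : Fin m → Matrix (ZMod 2) (ZMod 2) ℝ) :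
    (tensorMatrix A)ᵀ = tensorMatrix (fun i => (A i)ᵀ) := rfl

theorem tensorMatrix_mem {m : ℕ} (A : Fin m → Matrix.orthogonalGroup (ZMod 2) ℝ) :
    tensorMatrix (fun i => (A i).1) ∈ Matrix.orthogonalGroup (V m) ℝ := by
  rw [Matrix.mem_orthogonalGroup_iff, tensorMatrix_transpose, ← tensorMatrix_mul]
  have h : ∀ i, (A i).1 * (A i).1ᵀ = 1 := fun i =>
    (Matrix.mem_orthogonalGroup_iff (ZMod 2) ℝ).mp (A i).2
  simp only [h]
  exact tensorMatrix_one

/-- The tensor product of orthogonal matrices, `O(2,ℝ)^m → O(2^m,ℝ)`. -/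
def tensorHom (m : ℕ) :
    (Fin m → Matrix.orthogonalGroup (ZMod 2) ℝ) →* Matrix.orthogonalGroup (V m) ℝ where
  toFun A := ⟨tensorMatrix fun i => (A i).1, tensorMatrix_mem A⟩
  map_one' := Subtype.ext tensorMatrix_one
  map_mul' A B := Subtype.ext (tensorMatrix_mul (fun i => (A i).1) fun i => (B i).1)

/-- The matrix with rows `(0, 1)` and `(1, 0)`. -/
def sigma1Matrix : Matrix (ZMod 2) (ZMod 2) ℝ := Matrix.of fun a b => if a = b then 0 else 1

/-- The matrix with rows `(1, 0)` and `(0, -1)`. -/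
def sigma2Matrix : Matrix (ZMod 2) (ZMod 2) ℝ := Matrix.diagonal fun a => if a = 0 then 1 else -1

theorem sigma1Matrix_mem : sigma1Matrix ∈ Matrix.orthogonalGroup (ZMod 2) ℝ := by
  rw [Matrix.mem_orthogonalGroup_iff]
  ext i j
  have h : ∑ k : ZMod 2, (if i = k then 0 else 1) * (if j = k then 0 else 1) =
      if i = j then 1 else 0 := by
    revert i j
    decide
  simp only [sigma1Matrix, Matrix.mul_apply, Matrix.transpose_apply, Matrix.of_apply,
    Matrix.one_apply]
  exact_mod_cast congrArg (Nat.cast : ℕ → ℝ) h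

theorem sigma2Matrix_mem : sigma2Matrix ∈ Matrix.orthogonalGroup (ZMod 2) ℝ := by
  rw [Matrix.mem_orthogonalGroup_iff, sigma2Matrix, Matrix.diagonal_transpose,
    Matrix.diagonal_mul_diagonal, ← Matrix.diagonal_one]
  congr 1
  funext a
  split_ifs <;> norm_num

def sigma1 : Matrix.orthogonalGroup (ZMod 2) ℝ := ⟨sigma1Matrix, sigma1Matrix_mem⟩

def sigma2 : Matrix.orthogonalGroup (ZMod 2) ℝ := ⟨sigma2Matrix, sigma2Matrix_mem⟩

/-- `E(1) = ⟨σ₁, σ₂⟩`, the dihedral group of order 8. -/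
def E1 : Subgroup (Matrix.orthogonalGroup (ZMod 2) ℝ) := Subgroup.closure {sigma1, sigma2}

/-- The extraspecial 2-group `E(m) = E(1) ⊗ ⋯ ⊗ E(1)` in `O(2^m, ℝ)`: all tensor products
`g_1 ⊗ ⋯ ⊗ g_m` with every `g_i` in `E(1)`. -/
def E (m : ℕ) : Subgroup (Matrix.orthogonalGroup (V m) ℝ) :=
  (Subgroup.pi Set.univ fun _ : Fin m => E1).map (tensorHom m)

/-- The real Clifford group: the normalizer of `E(m)` in `O(2^m, ℝ)`. -/
def cliffordGroup (m : ℕ) : Subgroup (Matrix.orthogonalGroup (V m) ℝ) :=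
  Subgroup.normalizer (E m)

/-! ### The Barnes-Wall lattices -/

/-- The characteristic vector `χ_U` of a subset of `F_2^m`. -/
noncomputable def chi {m : ℕ} (U : Set (V m)) : V m → ℝ := U.indicator 1

/-- The `ℤ`-span of the vectors `2^⌊(m-d+δ)/2⌋ χ_U`, where `U` ranges over the (nonempty) affine
subspaces of `F_2^m` and `d = dim U`. As `d ≤ m`, the subtraction does not truncate. -/
noncomputable def spanLattice (δ m : ℕ) : Submodule ℤ (V m → ℝ) :=
  Submodule.span ℤ {x | ∃ U : AffineSubspace (ZMod 2) (V m), (U : Set (V m)).Nonempty ∧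
    x = (2 : ℝ) ^ ((m - Module.finrank (ZMod 2) U.direction + δ) / 2) • chi (U : Set (V m))}

/-- The Barnes-Wall lattice `L_m`. -/
noncomputable def L (m : ℕ) : Submodule ℤ (V m → ℝ) := spanLattice 1 m

/-- The Barnes-Wall lattice `L'_m`. -/
noncomputable def L' (m : ℕ) : Submodule ℤ (V m → ℝ) := spanLattice 0 m

/-- The ring `ℤ[√2]`, as a subring of `ℝ`. -/
noncomputable abbrev ZSqrt2 : Subalgebra ℤ ℝ := Algebra.adjoin ℤ {Real.sqrt 2}

/-- The balanced Barnes-Wall lattice: the `ℤ[√2]`-lattice `M_m = √2 L'_m + L_m`. -/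
noncomputable def M (m : ℕ) : Submodule ZSqrt2 (V m → ℝ) :=
  Submodule.span ZSqrt2 ((fun x => Real.sqrt 2 • x) '' (L' m : Set (V m → ℝ))) ⊔
    Submodule.span ZSqrt2 (L m : Set (V m → ℝ))

/-- The orthogonal automorphism group of a lattice `Λ` in `ℝ^ι`: all `g ∈ O(ι, ℝ)` with
`g Λ = Λ`. -/
def orthogonalAut {ι R : Type*} [Fintype ι] [DecidableEq ι] [Semiring R] [Module R (ι → ℝ)]
    (Λ : Submodule R (ι → ℝ)) : Subgroup (Matrix.orthogonalGroup ι ℝ) where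
  carrier := {g | ∀ x : ι → ℝ, g.1 *ᵥ x ∈ Λ ↔ x ∈ Λ}
  one_mem' x := by simp
  mul_mem' {g h} hg hh x := by
    change (g.1 * h.1) *ᵥ x ∈ Λ ↔ x ∈ Λ
    rw [← Matrix.mulVec_mulVec]
    exact (hg _).trans (hh x)
  inv_mem' {g} hg x := by
    refine (hg _).symm.trans ?_
    have h : g.1 * (g⁻¹).1 = 1 := congrArg Subtype.val (mul_inv_cancel g)
    rw [Matrix.mulVec_mulVec, h, Matrix.one_mulVec]

end BarnesWall

namespace BarnesWall

/-! `M m` is free over `ℤ[√2]` on the tensor products of the vectors `(√2, 0)` and `(1, 1)`, and it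
is `√2 ^ m`-modular: a vector lies in it once its inner products with this basis are divisible by
`√2 ^ m` (`M_eq_basisLattice`, `mem_basisLattice_of_dotProduct`).

Clifford elements preserve the lattice. For a basis vector `f`, `f fᵀ` is the sum of an elementary
abelian subgroup of `E m` (`exists_stabilizer`). If `n` normalizes `E m` and `y` is a basis vector,
then `(y · n f)²` is a sum of terms `y · (e y)` with `e` in `E m`. Each such `e` fixes `y`, negates
it or makes it orthogonal to itself, so the sum is `0` or `2 ^ j * 2 ^ m`. Hence `y · n f` is `0` or
`± √2 ^ (m + j)`, and modularity puts `n f` in the lattice.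

Conversely, `E m` is exactly the kernel of the action of the automorphism group on the lattice
modulo `√2`, and a kernel is normal. The hard inclusion is `mem_E_of_dvdEnd_one`. If `g ≡ 1` modulo
`√2`, its commutator `c` with `x` in `E m` is `1` modulo `√2 ^ 2`, and the commutator of `c` with
any element of `E m` is `1` modulo `√2 ^ 3`. A Minkowski-type argument (`eq_one_of_dvdEnd_three`)
makes the latter trivial. By absolute irreducibility `c = ± 1`, so `g` commutes with the generators
of `E m` up to signs. Some element of `E m` has the same signs, and differs from `g` by a scalar `±
1`. -/

/-! ### The ring `ℤ[√2]` and its two real embeddings -/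

/-- The embedding `ℤ[√2] → ℝ` sending `√2` to a given square root of `2`. -/
def embed (r : ℝ) (hr : r * r = 2) : ℤ√2 →+* ℝ := Zsqrtd.lift ⟨r, by simpa using hr⟩

theorem embed_apply (r : ℝ) (hr : r * r = 2) (x : ℤ√2) : embed r hr x = x.re + x.im * r := by
  simp [embed]

theorem sqrt_two_mul_self : √2 * √2 = (2 : ℝ) := Real.mul_self_sqrt (by norm_num)

/-- The embedding `ℤ[√2] → ℝ` with positive image of `√2`. -/
noncomputable def iota : ℤ√2 →+* ℝ := embed (√2) sqrt_two_mul_self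

/-- The embedding `ℤ[√2] → ℝ` with negative image of `√2`. -/
noncomputable def iota' : ℤ√2 →+* ℝ := embed (-√2) (by rw [neg_mul_neg, sqrt_two_mul_self])

theorem iota_apply (x : ℤ√2) : iota x = x.re + x.im * √2 := embed_apply _ _ _

theorem iota'_apply (x : ℤ√2) : iota' x = x.re - x.im * √2 := by
  rw [iota', embed_apply]; ring

theorem sqrtd_mul_self : (Zsqrtd.sqrtd : ℤ√2) * Zsqrtd.sqrtd = 2 := by
  ext <;> simp

theorem iota_sqrtd : iota Zsqrtd.sqrtd = √2 := by simp [iota_apply]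

theorem iota_sqrtd_pow (k : ℕ) : iota (Zsqrtd.sqrtd ^ k) = √2 ^ k := by
  rw [map_pow, iota_sqrtd]

theorem sqrt_two_pow_ne_zero (k : ℕ) : (√2 : ℝ) ^ k ≠ 0 :=
  pow_ne_zero _ (by positivity)

/-- The integer part and `√2` times the other coefficient are the half-sum and half-difference of
the two embeddings. One embedding alone would not do, since its image is dense in `ℝ`. -/
theorem eq_zero_of_abs_embed_lt_one {x : ℤ√2} (h : |iota x| < 1) (h' : |iota' x| < 1) : x = 0 := by
  rw [iota_apply, abs_lt] at h
  rw [iota'_apply, abs_lt] at h'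
  have hs : (1 : ℝ) ≤ √2 := Real.one_le_sqrt.mpr (by norm_num)
  have h1 : |(x.re : ℝ)| < 1 := by rw [abs_lt]; constructor <;> linarith
  have h3 : |(x.im : ℝ) * √2| < 1 := by rw [abs_lt]; constructor <;> linarith
  have h2 : |(x.im : ℝ)| < 1 := by
    rw [abs_mul, abs_of_nonneg (by positivity : (0 : ℝ) ≤ √2)] at h3
    nlinarith [abs_nonneg (x.im : ℝ)]
  have h1' : |x.re| < 1 := by exact_mod_cast h1
  have h2' : |x.im| < 1 := by exact_mod_cast h2
  ext
  · exact Int.abs_lt_one_iff.mp h1'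
  · exact Int.abs_lt_one_iff.mp h2'

theorem iota_injective : Function.Injective iota := by
  rw [injective_iff_map_eq_zero]
  intro x hx
  have h : iota (x * star x) = 0 := by rw [map_mul, hx, zero_mul]
  have h2 : x * star x = 0 := by
    rw [← Zsqrtd.norm_eq_mul_conj] at h ⊢
    rw [iota_apply] at h
    simpa using h
  have hd : Zsqrtd.norm x = 0 := by
    rw [← Zsqrtd.norm_eq_mul_conj] at h2
    exact_mod_cast h2
  refine (Zsqrtd.norm_eq_zero ?_ x).mp hd
  rintro n hn
  have : n ≤ 1 := by nlinarith
  have : -1 ≤ n := by nlinarith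
  interval_cases n <;> omega

instance isDomain_sqrtTwo : IsDomain (ℤ√2) := iota_injective.isDomain iota

/-- Moves scalars to `ℤ√2`, where equality is decidable and the `2 × 2` identities below are settled
by `decide`. -/
theorem mem_ZSqrt2_iff {x : ℝ} : x ∈ ZSqrt2 ↔ ∃ z, iota z = x := by
  constructor
  · intro h
    induction h using Algebra.adjoin_induction with
    | mem x hx => exact ⟨Zsqrtd.sqrtd, by rw [iota_sqrtd, hx]⟩
    | algebraMap r => exact ⟨r, by simp⟩
    | add x y _ _ hx hy =>
      obtain ⟨a, rfl⟩ := hx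
      obtain ⟨b, rfl⟩ := hy
      exact ⟨a + b, map_add _ _ _⟩
    | mul x y _ _ hx hy =>
      obtain ⟨a, rfl⟩ := hx
      obtain ⟨b, rfl⟩ := hy
      exact ⟨a * b, map_mul _ _ _⟩
  · rintro ⟨z, rfl⟩
    rw [iota_apply]
    refine add_mem (intCast_mem _ _) (mul_mem (intCast_mem _ _) ?_)
    exact Algebra.subset_adjoin rfl

/-! ### Tensor products of matrices over a commutative ring -/

/-- The Kronecker product of `2 × 2` matrices over a commutative ring. -/
def tens {S : Type*} [CommRing S] {m : ℕ} (A : Fin m → Matrix (ZMod 2) (ZMod 2) S) :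
    Matrix (V m) (V m) S :=
  Matrix.of fun v w => ∏ i, A i (v i) (w i)

section tens

variable {S T : Type*} [CommRing S] [CommRing T] {m : ℕ}

theorem tens_mul (A B : Fin m → Matrix (ZMod 2) (ZMod 2) S) :
    tens (fun i => A i * B i) = tens A * tens B := by
  ext v w
  simp only [tens, Matrix.of_apply, Matrix.mul_apply]
  rw [Fintype.prod_sum]
  exact Finset.sum_congr rfl fun x _ => Finset.prod_mul_distrib

theorem tens_smul_one (c : S) :
    tens (fun _ : Fin m => c • (1 : Matrix (ZMod 2) (ZMod 2) S)) = c ^ m • 1 := by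
  ext v w
  simp only [tens, Matrix.of_apply, Matrix.smul_apply, Matrix.one_apply, smul_eq_mul]
  by_cases h : v = w
  · subst h
    simp
  · obtain ⟨i, hi⟩ := Function.ne_iff.mp h
    rw [if_neg h, mul_zero]
    exact Finset.prod_eq_zero (Finset.mem_univ i) (by rw [if_neg hi, mul_zero])

theorem tens_transpose (A : Fin m → Matrix (ZMod 2) (ZMod 2) S) :
    (tens A)ᵀ = tens (fun i => (A i)ᵀ) := rfl

theorem tens_map (φ : S →+* T) (A : Fin m → Matrix (ZMod 2) (ZMod 2) S) :
    φ.mapMatrix (tens A) = tens fun i => φ.mapMatrix (A i) := by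
  ext v w
  simp [tens, map_prod]

end tens

/-! ### A basis of the balanced lattice -/

/-- The matrix with columns `(√2, 0)` and `(1, 1)`. -/
def basisTwo : Matrix (ZMod 2) (ZMod 2) (ℤ√2) :=
  Matrix.of fun a b => if b = 1 then 1 else if a = 0 then Zsqrtd.sqrtd else 0

/-- `√2` times the inverse of the Gram matrix of the columns of `basisTwo`. -/
def dualTwo : Matrix (ZMod 2) (ZMod 2) (ℤ√2) :=
  Matrix.of fun a b => if a = b then Zsqrtd.sqrtd else -1

theorem basisTwo_mul_dualTwo : basisTwo * dualTwo * basisTwoᵀ = (Zsqrtd.sqrtd : ℤ√2) • 1 := by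
  decide

theorem dualTwo_mul_basisTwo : dualTwo * (basisTwoᵀ * basisTwo) = (Zsqrtd.sqrtd : ℤ√2) • 1 := by
  decide

/-- The matrix whose columns are the tensor products of the columns of `basisTwo`. -/
def basisMatrix (m : ℕ) : Matrix (V m) (V m) (ℤ√2) := tens fun _ => basisTwo

/-- `√2 ^ m` times the inverse of the Gram matrix of the columns of `basisMatrix m`. -/
def dualMatrix (m : ℕ) : Matrix (V m) (V m) (ℤ√2) := tens fun _ => dualTwo

theorem basisMatrix_mul_dualMatrix (m : ℕ) :
    basisMatrix m * dualMatrix m * (basisMatrix m)ᵀ = (Zsqrtd.sqrtd : ℤ√2) ^ m • 1 := by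
  rw [basisMatrix, dualMatrix, tens_transpose, ← tens_mul, ← tens_mul, ← tens_smul_one]
  simp only [basisTwo_mul_dualTwo]

theorem dualMatrix_mul_basisMatrix (m : ℕ) :
    dualMatrix m * ((basisMatrix m)ᵀ * basisMatrix m) = (Zsqrtd.sqrtd : ℤ√2) ^ m • 1 := by
  rw [basisMatrix, dualMatrix, tens_transpose, ← tens_mul, ← tens_mul, ← tens_smul_one]
  simp only [dualTwo_mul_basisTwo]

theorem gram_diag (m : ℕ) (w : V m) : ((basisMatrix m)ᵀ * basisMatrix m) w w = 2 ^ m := by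
  rw [basisMatrix, tens_transpose, ← tens_mul]
  have h : ∀ b, (basisTwoᵀ * basisTwo) b b = (2 : ℤ√2) := by decide
  simp [tens, h]

/-- `basisMatrix` as a real matrix. -/
noncomputable def realBasis (m : ℕ) : Matrix (V m) (V m) ℝ := iota.mapMatrix (basisMatrix m)

/-- The lattice vectors, in terms of the basis. -/
noncomputable def basisLattice (m : ℕ) : Submodule ZSqrt2 (V m → ℝ) where
  carrier := {x | ∃ c : V m → ℤ√2, x = realBasis m *ᵥ (iota ∘ c)}
  zero_mem' := ⟨0, by
    have : (iota ∘ (0 : V m → ℤ√2)) = 0 := by ext; simp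
    rw [this, Matrix.mulVec_zero]⟩
  add_mem' := by
    rintro _ _ ⟨c, rfl⟩ ⟨d, rfl⟩
    refine ⟨c + d, ?_⟩
    rw [← Matrix.mulVec_add]
    congr 1
    ext; simp
  smul_mem' := by
    rintro ⟨r, hr⟩ _ ⟨c, rfl⟩
    obtain ⟨z, rfl⟩ := mem_ZSqrt2_iff.mp hr
    refine ⟨z • c, ?_⟩
    change iota z • (realBasis m *ᵥ (iota ∘ c)) = _
    rw [← Matrix.mulVec_smul]
    congr 1
    ext; simp

theorem realBasis_col_mem (m : ℕ) (w : V m) : (realBasis m)ᵀ w ∈ basisLattice m := by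
  refine ⟨Pi.single w 1, ?_⟩
  have : (iota ∘ (Pi.single w 1 : V m → ℤ√2)) = Pi.single w 1 := by
    ext v
    simp [Pi.single_apply, apply_ite iota]
  rw [this, Matrix.mulVec_single_one]
  rfl

/-- The lattice is `√2 ^ m`-modular. -/
theorem mem_basisLattice_of_dotProduct {m : ℕ} {x : V m → ℝ}
    (h : ∀ w, ∃ z : ℤ√2, (realBasis m)ᵀ w ⬝ᵥ x = √2 ^ m * iota z) : x ∈ basisLattice m := by
  choose z hz using h
  -- With `B` the basis matrix, `Bᵀ x = √2 ^ m z` and `B * dualMatrix * Bᵀ = √2 ^ m`; cancelling `√2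
  -- ^ m` gives these coordinates.
  refine ⟨dualMatrix m *ᵥ z, ?_⟩
  have h1 : (realBasis m)ᵀ *ᵥ x = √2 ^ m • (iota ∘ z) := by
    ext w
    exact hz w
  have h2 := congrArg iota.mapMatrix (basisMatrix_mul_dualMatrix m)
  have h3 : iota.mapMatrix ((Zsqrtd.sqrtd : ℤ√2) ^ m • (1 : Matrix (V m) (V m) (ℤ√2))) =
      √2 ^ m • 1 := by
    ext v w
    simp [Matrix.one_apply, apply_ite iota, iota_sqrtd]
  rw [h3, map_mul, map_mul] at h2
  have h4 : iota.mapMatrix (basisMatrix m)ᵀ = (realBasis m)ᵀ := rfl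
  rw [h4] at h2
  have h5 := congrArg (· *ᵥ x) h2
  simp only [← Matrix.mulVec_mulVec, h1, Matrix.smul_mulVec, Matrix.one_mulVec,
    Matrix.mulVec_smul] at h5
  have h6 := smul_right_injective (V m → ℝ) (sqrt_two_pow_ne_zero m) h5
  rw [← h6]
  congr 1
  ext v
  simp [Matrix.mulVec, dotProduct, map_sum]

/-! ### The balanced lattice is spanned by the basis -/

/-- Coordinate subspace: the vectors which vanish wherever `w` does. -/
def coordSubspace {m : ℕ} (w : V m) : Submodule (ZMod 2) (V m) :=
  LinearMap.ker (LinearMap.funLeft (ZMod 2) (ZMod 2) (Subtype.val : {i // w i = 0} → Fin m))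

theorem mem_coordSubspace {m : ℕ} {v w : V m} :
    v ∈ coordSubspace w ↔ ∀ i, w i = 0 → v i = 0 := by
  simp only [coordSubspace, LinearMap.mem_ker, funext_iff, LinearMap.funLeft_apply,
    Subtype.forall, Pi.zero_apply]

theorem finrank_coordSubspace {m : ℕ} (w : V m) :
    Fintype.card {i // w i = 0} + Module.finrank (ZMod 2) (coordSubspace w) = m := by
  have h := LinearMap.finrank_range_add_finrank_ker
    (LinearMap.funLeft (ZMod 2) (ZMod 2) (Subtype.val : {i // w i = 0} → Fin m))
  rw [LinearMap.range_eq_top.mpr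
    (LinearMap.funLeft_surjective_of_injective _ _ _ Subtype.val_injective), finrank_top,
    Module.finrank_fintype_fun_eq_card, Module.finrank_fin_fun] at h
  exact h

open Classical in
theorem realBasis_apply {m : ℕ} (v w : V m) :
    realBasis m v w = if v ∈ coordSubspace w then √2 ^ Fintype.card {i // w i = 0} else 0 := by
  have h1 : realBasis m v w = ∏ i, if w i = 0 then (if v i = 0 then √2 else 0) else (1 : ℝ) := by
    simp only [realBasis, RingHom.mapMatrix_apply, Matrix.map_apply, basisMatrix, tens,
      Matrix.of_apply, map_prod]
    refine Finset.prod_congr rfl fun i _ => ?_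
    have h : ∀ a : ZMod 2, a = 0 ∨ a = 1 := by decide
    rcases h (w i) with hw | hw
    · simp [basisTwo, hw, apply_ite iota, iota_sqrtd]
    · simp [basisTwo, hw]
  rw [h1, ← Finset.prod_filter]
  split_ifs with hv
  · rw [mem_coordSubspace] at hv
    rw [Finset.prod_congr rfl fun i hi => if_pos (hv i (Finset.mem_filter.mp hi).2),
      Finset.prod_const, Fintype.card_subtype]
  · rw [mem_coordSubspace] at hv
    push Not at hv
    obtain ⟨i, hi, hvi⟩ := hv
    exact Finset.prod_eq_zero (Finset.mem_filter.mpr ⟨Finset.mem_univ i, hi⟩) (if_neg hvi)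

theorem realBasis_col {m : ℕ} (w : V m) :
    (realBasis m)ᵀ w = √2 ^ (m - Module.finrank (ZMod 2) (coordSubspace w)) •
      chi (coordSubspace w : Set (V m)) := by
  ext v
  have h := finrank_coordSubspace w
  rw [Matrix.transpose_apply, realBasis_apply, show m - Module.finrank (ZMod 2) (coordSubspace w)
    = Fintype.card {i // w i = 0} by omega]
  by_cases hv : v ∈ coordSubspace w <;> simp [chi, hv]

theorem two_pow_eq (k : ℕ) : (2 : ℝ) ^ k = √2 ^ (2 * k) := by
  rw [pow_mul, pow_two, sqrt_two_mul_self]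

theorem sqrt_two_mem : √2 ∈ ZSqrt2 := Algebra.subset_adjoin rfl

/-- The floors in the two lattices interlock: even codimension is supplied by `L m`, odd codimension
by `√2 L' m`. With `M_le`, this makes `M m` the span of the vectors `√2 ^ codim • χ_U`. -/
theorem smul_chi_mem_M {m : ℕ} (U : AffineSubspace (ZMod 2) (V m)) (hU : (U : Set (V m)).Nonempty) :
    √2 ^ (m - Module.finrank (ZMod 2) U.direction) • chi (U : Set (V m)) ∈ M m := by
  obtain ⟨k, hk⟩ : ∃ k, k = m - Module.finrank (ZMod 2) U.direction := ⟨_, rfl⟩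
  rw [← hk]
  rcases Nat.even_or_odd' k with ⟨j, rfl | rfl⟩
  · refine Submodule.mem_sup_right (Submodule.subset_span (Submodule.subset_span ⟨U, hU, ?_⟩))
    rw [← hk, show (2 * j + 1) / 2 = j by omega, two_pow_eq]
  · refine Submodule.mem_sup_left (Submodule.subset_span
      ⟨(2 : ℝ) ^ j • chi (U : Set (V m)), Submodule.subset_span ⟨U, hU, ?_⟩, ?_⟩)
    · rw [← hk, show (2 * j + 1 + 0) / 2 = j by omega]
    · change √2 • _ = _
      rw [smul_smul, two_pow_eq, pow_succ']

theorem M_le {m : ℕ} {N : Submodule ZSqrt2 (V m → ℝ)}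
    (h : ∀ U : AffineSubspace (ZMod 2) (V m), (U : Set (V m)).Nonempty →
      √2 ^ (m - Module.finrank (ZMod 2) U.direction) • chi (U : Set (V m)) ∈ N) : M m ≤ N := by
  have hs : ∀ x ∈ N, √2 • x ∈ N := fun x hx => N.smul_mem (⟨√2, sqrt_two_mem⟩ : ZSqrt2) hx
  have key : ∀ (U : AffineSubspace (ZMod 2) (V m)), (U : Set (V m)).Nonempty → ∀ j,
      m - Module.finrank (ZMod 2) U.direction ≤ j → √2 ^ j • chi (U : Set (V m)) ∈ N := by
    intro U hU j hj
    induction j, hj using Nat.le_induction with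
    | base => exact h U hU
    | succ j _ ih =>
      rw [pow_succ', ← smul_smul]
      exact hs _ ih
  refine sup_le (Submodule.span_le.mpr ?_) (Submodule.span_le.mpr ?_)
  · rintro _ ⟨x, hx, rfl⟩
    change √2 • x ∈ N
    induction hx using Submodule.span_induction with
    | mem x hx =>
      obtain ⟨U, hU, rfl⟩ := hx
      rw [smul_smul, two_pow_eq, ← pow_succ']
      exact key U hU _ (by omega)
    | zero => simp
    | add x y _ _ hx hy => rw [smul_add]; exact add_mem hx hy
    | smul a x _ hx => rw [smul_comm]; exact zsmul_mem hx a
  · intro x hx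
    change x ∈ N
    induction hx using Submodule.span_induction with
    | mem x hx =>
      obtain ⟨U, hU, rfl⟩ := hx
      rw [two_pow_eq]
      exact key U hU _ (by omega)
    | zero => simp
    | add x y _ _ hx hy => exact add_mem hx hy
    | smul a x _ hx => exact zsmul_mem hx a

theorem chi_dotProduct_chi {m : ℕ} (U W : Set (V m)) : chi U ⬝ᵥ chi W = Nat.card (U ∩ W : Set (V m)) := by
  classical
  have h : ∀ v, chi U v * chi W v = if v ∈ U ∩ W then 1 else 0 := by
    intro v
    simp only [chi, Set.indicator_apply, Pi.one_apply, Set.mem_inter_iff, ite_and]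
    split_ifs <;> simp
  rw [dotProduct, Finset.sum_congr rfl fun v _ => h v, Finset.sum_boole, Nat.card_eq_fintype_card,
    Fintype.card_subtype]

/-- Two intersecting affine subspaces of `F_2^m` meet in a set of `2 ^ j` points, where `j` is
bounded below by the dimension formula. -/
theorem card_inter_coordSubspace {m : ℕ} (U : AffineSubspace (ZMod 2) (V m)) (w : V m) :
    Nat.card ((U : Set (V m)) ∩ (coordSubspace w : Set (V m)) : Set (V m)) = 0 ∨
    ∃ j, Nat.card ((U : Set (V m)) ∩ (coordSubspace w : Set (V m)) : Set (V m)) = 2 ^ j ∧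
      Module.finrank (ZMod 2) U.direction + Module.finrank (ZMod 2) (coordSubspace w) ≤ m + j := by
  rcases Set.eq_empty_or_nonempty ((U : Set (V m)) ∩ (coordSubspace w : Set (V m))) with h | h
  · left
    rw [h]
    simp
  · right
    obtain ⟨p, hpU, hpw⟩ := h
    have e : ((U : Set (V m)) ∩ (coordSubspace w : Set (V m)) : Set (V m)) =
        (fun x => x + p) '' (U.direction ⊓ coordSubspace w : Submodule (ZMod 2) (V m)) := by
      ext x
      constructor
      · rintro ⟨hU, hw⟩
        exact ⟨x - p, ⟨AffineSubspace.vsub_mem_direction hU hpU, sub_mem hw hpw⟩,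
          sub_add_cancel x p⟩
      · rintro ⟨y, ⟨hU, hw⟩, rfl⟩
        exact ⟨AffineSubspace.vadd_mem_of_mem_direction hU hpU, add_mem hw hpw⟩
    refine ⟨Module.finrank (ZMod 2) (U.direction ⊓ coordSubspace w : Submodule (ZMod 2) (V m)),
      ?_, ?_⟩
    · rw [e, Nat.card_image_of_injective (add_left_injective p)]
      have := Module.natCard_eq_pow_finrank (K := ZMod 2)
        (V := (U.direction ⊓ coordSubspace w : Submodule (ZMod 2) (V m)))
      rw [Nat.card_zmod] at this
      exact this
    · have h2 := Submodule.finrank_le (U.direction ⊔ coordSubspace w)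
      rw [Module.finrank_fin_fun] at h2
      exact (Submodule.finrank_sup_add_finrank_inf_eq _ _).symm.trans_le
        (Nat.add_le_add_right h2 _)

theorem M_eq_basisLattice (m : ℕ) : M m = basisLattice m := by
  refine le_antisymm (M_le fun U hU => mem_basisLattice_of_dotProduct fun w => ?_) ?_
  · rw [realBasis_col, smul_dotProduct, dotProduct_smul, dotProduct_comm, chi_dotProduct_chi,
      smul_eq_mul, smul_eq_mul]
    rcases card_inter_coordSubspace U w with h | ⟨j, h, hj⟩
    · exact ⟨0, by rw [h]; simp⟩
    · have h1 := finrank_coordSubspace w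
      have h2 := Submodule.finrank_le U.direction
      rw [Module.finrank_fin_fun] at h2
      rw [h, Nat.cast_pow, Nat.cast_ofNat, two_pow_eq, ← pow_add, ← pow_add]
      -- The two codimensions and the `2 ^ j` common points give `√2` to the power `2m - d - d' +
      -- 2j`. This is at least `m` because `d + d' ≤ m + j`, so the truncated subtraction is
      -- harmless.
      refine ⟨Zsqrtd.sqrtd ^ (m - Module.finrank (ZMod 2) (coordSubspace w) +
        (m - Module.finrank (ZMod 2) U.direction + 2 * j) - m), ?_⟩
      rw [iota_sqrtd_pow, ← pow_add]
      congr 1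
      omega
  · rintro _ ⟨c, rfl⟩
    rw [Matrix.mulVec_eq_sum]
    refine sum_mem fun w _ => ?_
    have h : (realBasis m)ᵀ w ∈ M m := by
      rw [realBasis_col]
      have := smul_chi_mem_M (coordSubspace w).toAffineSubspace ⟨0, (coordSubspace w).zero_mem⟩
      rwa [Submodule.toAffineSubspace_direction] at this
    rw [op_smul_eq_smul]
    exact (M m).smul_mem (⟨iota (c w), mem_ZSqrt2_iff.mpr ⟨_, rfl⟩⟩ : ZSqrt2) h

/-! ### Congruences between endomorphisms of the lattice -/

/-- `h` maps the lattice into its multiple by `√2 ^ k`. -/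
def DvdEnd {m : ℕ} (k : ℕ) (h : Matrix (V m) (V m) ℝ) : Prop :=
  ∃ K : Matrix (V m) (V m) (ℤ√2), h * realBasis m = √2 ^ k • (realBasis m * iota.mapMatrix K)

section DvdEnd

variable {m k l : ℕ} {g h : Matrix (V m) (V m) ℝ}

theorem DvdEnd.mul (hg : DvdEnd k g) (hh : DvdEnd l h) : DvdEnd (k + l) (g * h) := by
  obtain ⟨A, hA⟩ := hg
  obtain ⟨B, hB⟩ := hh
  refine ⟨A * B, ?_⟩
  rw [Matrix.mul_assoc, hB, Matrix.mul_smul, ← Matrix.mul_assoc, hA, Matrix.smul_mul, smul_smul,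
    map_mul, Matrix.mul_assoc, pow_add, mul_comm]

theorem DvdEnd.sub (hg : DvdEnd k g) (hh : DvdEnd k h) : DvdEnd k (g - h) := by
  obtain ⟨A, hA⟩ := hg
  obtain ⟨B, hB⟩ := hh
  exact ⟨A - B, by rw [Matrix.sub_mul, hA, hB, map_sub, Matrix.mul_sub, smul_sub]⟩

theorem dvdEnd_of_mem_orthogonalAut {g : Matrix.orthogonalGroup (V m) ℝ}
    (hg : g ∈ orthogonalAut (M m)) : DvdEnd 0 g.1 := by
  have h : ∀ w, g.1 *ᵥ (realBasis m)ᵀ w ∈ basisLattice m := fun w => by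
    rw [← M_eq_basisLattice]
    refine (hg _).mpr ?_
    rw [M_eq_basisLattice]
    exact realBasis_col_mem m w
  choose c hc using h
  refine ⟨(Matrix.of c)ᵀ, ?_⟩
  rw [pow_zero, one_smul]
  ext v w
  exact congrFun (hc w) v

theorem DvdEnd.mulVec_mem (hg : DvdEnd 0 g) {x : V m → ℝ} (hx : x ∈ M m) : g *ᵥ x ∈ M m := by
  rw [M_eq_basisLattice] at hx ⊢
  obtain ⟨c, rfl⟩ := hx
  obtain ⟨K, hK⟩ := hg
  refine ⟨K *ᵥ c, ?_⟩
  rw [Matrix.mulVec_mulVec, hK, pow_zero, one_smul, ← Matrix.mulVec_mulVec]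
  congr 1
  ext v
  simp [Matrix.mulVec, dotProduct, map_sum]

theorem mem_orthogonalAut_of_dvdEnd {g : Matrix.orthogonalGroup (V m) ℝ}
    (hg : DvdEnd 0 g.1) (hg' : DvdEnd 0 (g⁻¹).1) : g ∈ orthogonalAut (M m) := by
  intro x
  refine ⟨fun hx => ?_, hg.mulVec_mem⟩
  have h := hg'.mulVec_mem hx
  have h1 : (g⁻¹).1 * g.1 = 1 := congrArg Subtype.val (inv_mul_cancel g)
  rwa [Matrix.mulVec_mulVec, h1, Matrix.one_mulVec] at h

end DvdEnd

/-! ### Isometries congruent to the identity -/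

theorem eq_zero_of_two_pow_dvd {x : ℤ√2} (h : ∀ n : ℕ, (2 : ℤ√2) ^ n ∣ x) : x = 0 := by
  have key : ∀ z : ℤ, (∀ n : ℕ, (2 : ℤ) ^ n ∣ z) → z = 0 := by
    intro z hz
    by_contra hne
    obtain ⟨n, hn⟩ := pow_unbounded_of_one_lt (|z|) (by norm_num : (1 : ℤ) < 2)
    exact absurd (Int.le_of_dvd (abs_pos.mpr hne) ((dvd_abs _ _).mpr (hz n))) (not_le.mpr hn)
  have h' : ∀ n : ℕ, (2 : ℤ) ^ n ∣ x.re ∧ (2 : ℤ) ^ n ∣ x.im := fun n => by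
    rw [← Zsqrtd.intCast_dvd]
    exact_mod_cast h n
  ext
  · exact key _ fun n => (h' n).1
  · exact key _ fun n => (h' n).2

section

variable {n : Type*} [Fintype n] [DecidableEq n]

local notation "s₂" => (Zsqrtd.sqrtd : ℤ√2)

theorem sqrtd_sq : s₂ ^ 2 = 2 := by rw [pow_two, sqrtd_mul_self]

/-- Expanding the square gives `K = -√2 K²`, so `K` is divisible by every power of `√2`. The
exponent `3` cannot be lowered: `-1` is an involution congruent to `1` modulo `√2 ^ 2`. -/
theorem eq_one_of_mul_self_eq_one {A K : Matrix n n (ℤ√2)} (hA : A = 1 + s₂ ^ 3 • K)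
    (hAA : A * A = 1) : A = 1 := by
  have h2 : s₂ ≠ 0 := by decide
  have hK : K = (-s₂) • (K * K) := by
    have h : s₂ ^ 5 • (K - (-s₂) • (K * K)) = 0 := by
      have e : A * A - 1 = s₂ ^ 5 • (K - (-s₂) • (K * K)) := by
        rw [hA]
        simp only [mul_add, add_mul, one_mul, mul_one, Matrix.smul_mul, Matrix.mul_smul, smul_smul,
          smul_sub]
        have : s₂ ^ 5 • K = s₂ ^ 3 • K + s₂ ^ 3 • K := by
          rw [← add_smul]
          congr 1
        rw [this]
        have : s₂ ^ 5 * -s₂ = -(s₂ ^ 3 * s₂ ^ 3) := by ring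
        rw [this, neg_smul]
        abel
      rw [← e, hAA, sub_self]
    exact sub_eq_zero.mp ((smul_eq_zero.mp h).resolve_left (pow_ne_zero _ h2))
  have hpow : ∀ j : ℕ, ∃ B : Matrix n n (ℤ√2), K = s₂ ^ j • (B * K) := by
    intro j
    induction j with
    | zero => exact ⟨1, by simp⟩
    | succ j ih =>
      obtain ⟨B, hB⟩ := ih
      refine ⟨-(B * K), ?_⟩
      conv_lhs => rw [hB, hK]
      rw [Matrix.mul_smul, smul_smul, Matrix.neg_mul, smul_neg, ← neg_smul, Matrix.mul_assoc]
      congr 1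
      ring
  have hK0 : K = 0 := by
    refine Matrix.ext fun i j => ?_
    refine eq_zero_of_two_pow_dvd fun k => ?_
    obtain ⟨B, hB⟩ := hpow (2 * k)
    rw [hB, pow_mul, sqrtd_sq]
    exact ⟨_, rfl⟩
  rw [hA, hK0, smul_zero, add_zero]

/-- In a squaring the cross term gains a factor `2 = √2 ^ 2`, and the quadratic term gains even
more. -/
theorem pow_two_pow_congr {A K : Matrix n n (ℤ√2)} (hA : A = 1 + s₂ ^ 3 • K) (j : ℕ) :
    ∃ K', A ^ 2 ^ j = 1 + s₂ ^ (2 * j + 3) • K' := by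
  induction j with
  | zero => exact ⟨K, by simpa using hA⟩
  | succ j ih =>
    obtain ⟨B, hB⟩ := ih
    refine ⟨B + s₂ ^ (2 * j + 1) • (B * B), ?_⟩
    rw [pow_succ, pow_mul, hB, pow_two]
    simp only [Matrix.mul_add, Matrix.add_mul, Matrix.one_mul, Matrix.mul_one, Matrix.smul_mul,
      Matrix.mul_smul, smul_smul, smul_add, add_assoc]
    have h1 : s₂ ^ (2 * (j + 1) + 3) • B = s₂ ^ (2 * j + 3) • B + s₂ ^ (2 * j + 3) • B := by
      rw [← add_smul, ← two_mul, ← sqrtd_sq, ← pow_add]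
      congr 2
      ring
    have h2 : s₂ ^ (2 * (j + 1) + 3) * s₂ ^ (2 * j + 1) = s₂ ^ (2 * j + 3) * s₂ ^ (2 * j + 3) := by
      ring
    rw [h1, h2]
    abel

theorem eq_one_of_pow_two_pow_eq_one {A K : Matrix n n (ℤ√2)} (hA : A = 1 + s₂ ^ 3 • K) (j : ℕ)
    (h : A ^ 2 ^ j = 1) : A = 1 := by
  induction j with
  | zero => simpa using h
  | succ j ih =>
    apply ih
    obtain ⟨B, hB⟩ := pow_two_pow_congr hA j
    refine eq_one_of_mul_self_eq_one (K := s₂ ^ (2 * j) • B) ?_ ?_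
    · rw [hB, smul_smul, ← pow_add, add_comm 3]
    · rw [← pow_two, ← pow_mul, ← pow_succ, h]

end

/-- Isometries of the lattice have bounded coefficients, under any real embedding. -/
theorem abs_embed_le {m : ℕ} (φ : ℤ√2 →+* ℝ) {A : Matrix (V m) (V m) (ℤ√2)}
    (hA : Aᵀ * ((basisMatrix m)ᵀ * basisMatrix m) * A = (basisMatrix m)ᵀ * basisMatrix m)
    (v w : V m) : |φ ((basisMatrix m * A) v w)| ≤ 2 ^ m := by
  -- The column norm is an identity in `ℤ√2` that writes `2 ^ m` as a sum of squares, so it bounds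
  -- the entries under both embeddings.
  have h : ∑ u, φ ((basisMatrix m * A) u w) ^ 2 = 2 ^ m := by
    have h1 : ((basisMatrix m * A)ᵀ * (basisMatrix m * A)) w w = 2 ^ m := by
      rw [Matrix.transpose_mul, ← gram_diag m w, ← hA]
      simp only [Matrix.mul_assoc]
    have h2 := congrArg φ h1
    rw [Matrix.mul_apply, map_sum, map_pow, map_ofNat] at h2
    rw [← h2]
    refine Finset.sum_congr rfl fun u _ => ?_
    rw [map_mul, pow_two, Matrix.transpose_apply]
  have h3 : φ ((basisMatrix m * A) v w) ^ 2 ≤ 2 ^ m := by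
    rw [← h]
    exact Finset.single_le_sum (f := fun u => φ ((basisMatrix m * A) u w) ^ 2)
      (fun u _ => sq_nonneg _) (Finset.mem_univ v)
  refine abs_le_of_sq_le_sq (h3.trans ?_) (by positivity)
  rw [← pow_mul]
  exact pow_le_pow_right₀ (by norm_num) (by omega)

theorem basisMatrix_mul_left_cancel {m : ℕ} {A B : Matrix (V m) (V m) (ℤ√2)}
    (h : basisMatrix m * A = basisMatrix m * B) : A = B := by
  have h1 : dualMatrix m * ((basisMatrix m)ᵀ * basisMatrix m) * A =
      dualMatrix m * ((basisMatrix m)ᵀ * basisMatrix m) * B := by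
    simp only [Matrix.mul_assoc, h]
  rw [dualMatrix_mul_basisMatrix, Matrix.smul_mul, Matrix.smul_mul, Matrix.one_mul,
    Matrix.one_mul] at h1
  exact smul_right_injective _ (pow_ne_zero m (by decide : (Zsqrtd.sqrtd : ℤ√2) ≠ 0)) h1

theorem realBasis_mul_right_cancel {m : ℕ} {g h : Matrix (V m) (V m) ℝ}
    (e : g * realBasis m = h * realBasis m) : g = h := by
  have h2 := congrArg iota.mapMatrix (basisMatrix_mul_dualMatrix m)
  have h3 : iota.mapMatrix ((Zsqrtd.sqrtd : ℤ√2) ^ m • (1 : Matrix (V m) (V m) (ℤ√2))) =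
      √2 ^ m • 1 := by
    ext v w
    simp [Matrix.one_apply, apply_ite iota, iota_sqrtd]
  rw [h3, map_mul, map_mul, Matrix.mul_assoc] at h2
  change realBasis m * _ = _ at h2
  have h4 := congrArg (· * (iota.mapMatrix (dualMatrix m) * iota.mapMatrix (basisMatrix m)ᵀ)) e
  simp only [Matrix.mul_assoc, h2, Matrix.mul_smul, Matrix.mul_one] at h4
  exact smul_right_injective _ (sqrt_two_pow_ne_zero m) h4

theorem isometry_pow {n S : Type*} [Fintype n] [DecidableEq n] [CommRing S]
    {A G : Matrix n n S} (hA : Aᵀ * G * A = G) (k : ℕ) : (A ^ k)ᵀ * G * A ^ k = G := by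
  induction k with
  | zero => simp
  | succ k ih =>
    calc (A ^ (k + 1))ᵀ * G * A ^ (k + 1) = Aᵀ * ((A ^ k)ᵀ * G * A ^ k) * A := by
          rw [pow_succ, Matrix.transpose_mul]; simp only [Matrix.mul_assoc]
      _ = G := by rw [ih, hA]

/-- An isometry of the lattice congruent to the identity modulo `√2 ^ 3` is the identity. -/
theorem eq_one_of_dvdEnd_three {m : ℕ} {g : Matrix (V m) (V m) ℝ}
    (hg : g ∈ Matrix.orthogonalGroup (V m) ℝ) (h : DvdEnd 3 (g - 1)) : g = 1 := by
  obtain ⟨K, hK⟩ := h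
  obtain ⟨A, hA⟩ : ∃ A, A = 1 + (Zsqrtd.sqrtd : ℤ√2) ^ 3 • K := ⟨_, rfl⟩
  have hgA : g * realBasis m = realBasis m * iota.mapMatrix A := by
    have e : iota.mapMatrix A = 1 + √2 ^ 3 • iota.mapMatrix K := by
      rw [hA, map_add, map_one]
      congr 1
      ext v w
      simp [iota_sqrtd]
    rw [e, Matrix.mul_add, Matrix.mul_one, Matrix.mul_smul, ← hK, Matrix.sub_mul, Matrix.one_mul]
    abel
  have hiso : Aᵀ * ((basisMatrix m)ᵀ * basisMatrix m) * A = (basisMatrix m)ᵀ * basisMatrix m := by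
    have e : iota.mapMatrix (Aᵀ * ((basisMatrix m)ᵀ * basisMatrix m) * A) =
        iota.mapMatrix ((basisMatrix m)ᵀ * basisMatrix m) := by
      simp only [map_mul]
      change (iota.mapMatrix A)ᵀ * ((realBasis m)ᵀ * realBasis m) * iota.mapMatrix A =
        (realBasis m)ᵀ * realBasis m
      calc _ = (realBasis m * iota.mapMatrix A)ᵀ * (realBasis m * iota.mapMatrix A) := by
            rw [Matrix.transpose_mul]; simp only [Matrix.mul_assoc]
        _ = (realBasis m)ᵀ * (gᵀ * g) * realBasis m := by
            rw [← hgA, Matrix.transpose_mul]; simp only [Matrix.mul_assoc]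
        _ = _ := by
            have := (Matrix.mem_orthogonalGroup_iff' (V m) ℝ).mp hg
            rw [show gᵀ * g = 1 from this, Matrix.mul_one]
    exact Matrix.map_injective iota_injective e
  -- Two isometries differ by at most `2 ^ (m + 1)` in each entry, while the difference here is
  -- divisible by `√2 ^ (2 * (m + 2) + 3)`. The cofactor is then below `1` in both embeddings, hence
  -- zero.
  have hpow : A ^ 2 ^ (m + 2) = 1 := by
    obtain ⟨B, hB⟩ := pow_two_pow_congr hA (m + 2)
    have hb : ∀ (φ : ℤ√2 →+* ℝ) (v w : V m), |φ ((basisMatrix m * B) v w)| < 1 := by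
      intro φ v w
      have h1 := abs_embed_le φ (isometry_pow hiso (2 ^ (m + 2))) v w
      have h0 := abs_embed_le φ (A := 1) (by simp) v w
      have h2 : (basisMatrix m * A ^ 2 ^ (m + 2)) v w = (basisMatrix m * (1 : Matrix (V m) (V m) (ℤ√2))) v w +
          (Zsqrtd.sqrtd : ℤ√2) ^ (2 * (m + 2) + 3) * (basisMatrix m * B) v w := by
        rw [hB, Matrix.mul_add, Matrix.mul_smul]
        rfl
      rw [h2, map_add, map_mul, map_pow] at h1
      obtain ⟨y, hy⟩ : ∃ y, y = φ ((basisMatrix m * B) v w) := ⟨_, rfl⟩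
      obtain ⟨x, hx⟩ : ∃ x, x = φ ((basisMatrix m * (1 : Matrix (V m) (V m) (ℤ√2))) v w) :=
        ⟨_, rfl⟩
      obtain ⟨r, hr⟩ : ∃ r, r = φ Zsqrtd.sqrtd := ⟨_, rfl⟩
      rw [← hy, ← hx, ← hr] at h1
      rw [← hx] at h0
      rw [← hy]
      have hr2 : r ^ 2 = 2 := by rw [hr, ← map_pow, sqrtd_sq, map_ofNat]
      have hr1 : 1 ≤ |r| := by
        rw [← one_le_sq_iff_one_le_abs, hr2]
        norm_num
      have h3 : |r ^ (2 * (m + 2) + 3) * y| ≤ 2 ^ m + 2 ^ m := by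
        calc |r ^ (2 * (m + 2) + 3) * y| = |(x + r ^ (2 * (m + 2) + 3) * y) - x| := by ring_nf
          _ ≤ |x + r ^ (2 * (m + 2) + 3) * y| + |x| := abs_sub _ _
          _ ≤ _ := add_le_add h1 h0
      rw [abs_mul, abs_pow, pow_add, pow_mul, sq_abs, hr2, pow_add] at h3
      have h4 : 1 ≤ |r| ^ 3 := one_le_pow₀ hr1
      have h5 : (0 : ℝ) < 2 ^ m := by positivity
      by_contra hy1
      push Not at hy1
      have h6 : (1 : ℝ) ≤ |r| ^ 3 * |y| := by nlinarith
      nlinarith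
    have hB0 : basisMatrix m * B = basisMatrix m * 0 := by
      rw [Matrix.mul_zero]
      refine Matrix.ext fun v w => ?_
      exact eq_zero_of_abs_embed_lt_one (hb _ v w) (hb _ v w)
    rw [hB, basisMatrix_mul_left_cancel hB0, smul_zero, add_zero]
  have hA1 := eq_one_of_pow_two_pow_eq_one hA _ hpow
  apply realBasis_mul_right_cancel
  rw [hgA, hA1, map_one, Matrix.mul_one, Matrix.one_mul]

/-! ### The group `E(1)` -/

/-- The eight elements `(-1)^c σ₁^a σ₂^b` of `E(1)`, over `ℤ[√2]`. -/
def pauli (c a b : ZMod 2) : Matrix (ZMod 2) (ZMod 2) (ℤ√2) :=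
  Matrix.of fun i j => if j = i + a then (if c + b * j = 0 then 1 else -1) else 0

theorem pauli_mul (c a b c' a' b' : ZMod 2) :
    pauli c a b * pauli c' a' b' = pauli (c + c' + b * a') (a + a') (b + b') := by
  revert c a b c' a' b'
  decide

theorem pauli_transpose (c a b : ZMod 2) : (pauli c a b)ᵀ = pauli (c + a * b) a b := by
  revert c a b
  decide

theorem pauli_basisTwo (c a b j : ZMod 2) :
    (basisTwoᵀ * (pauli c a b * basisTwo)) j j = 0 ∨
    (∀ i, (pauli c a b * basisTwo) i j = basisTwo i j) ∨
    (∀ i, (pauli c a b * basisTwo) i j = -basisTwo i j) := by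
  revert c a b j
  decide

theorem pauli_congr_one (c a b : ZMod 2) :
    ∃ K, pauli c a b * basisTwo = basisTwo * (1 + (Zsqrtd.sqrtd : ℤ√2) • K) := by
  -- Since `√2` times the inverse of `basisTwo` is `dualTwo * basisTwoᵀ`, solving for `K` gives half
  -- of this product. The integer divisions by `2` are exact, as the final check confirms.
  refine ⟨Matrix.of fun i j =>
    ⟨((dualTwo * basisTwoᵀ * (pauli c a b - 1) * basisTwo) i j).re / 2,
      ((dualTwo * basisTwoᵀ * (pauli c a b - 1) * basisTwo) i j).im / 2⟩, ?_⟩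
  revert c a b
  decide

theorem sigma1Matrix_eq : sigma1Matrix = iota.mapMatrix (pauli 0 1 0) := by
  have h : ∀ i j : ZMod 2, j = i + 1 ↔ ¬ i = j := by decide
  ext i j
  simp only [sigma1Matrix, pauli, Matrix.of_apply, RingHom.mapMatrix_apply, Matrix.map_apply, h]
  by_cases hij : i = j <;> simp [hij]

theorem sigma2Matrix_eq : sigma2Matrix = iota.mapMatrix (pauli 0 0 1) := by
  ext i j
  simp only [sigma2Matrix, pauli, Matrix.of_apply, RingHom.mapMatrix_apply, Matrix.map_apply,
    Matrix.diagonal_apply]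
  by_cases hij : i = j
  · subst hij
    simp [apply_ite iota]
  · simp [hij, Ne.symm hij]

theorem exists_pauli_of_mem_E1 {g : Matrix.orthogonalGroup (ZMod 2) ℝ} (hg : g ∈ E1) :
    ∃ c a b, g.1 = iota.mapMatrix (pauli c a b) := by
  induction hg using Subgroup.closure_induction with
  | mem x hx =>
    rcases hx with rfl | rfl
    · exact ⟨_, _, _, sigma1Matrix_eq⟩
    · exact ⟨_, _, _, sigma2Matrix_eq⟩
  | one =>
    refine ⟨0, 0, 0, ?_⟩
    rw [show pauli 0 0 0 = 1 by decide, map_one]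
    rfl
  | mul x y _ _ hx hy =>
    obtain ⟨c, a, b, h⟩ := hx
    obtain ⟨c', a', b', h'⟩ := hy
    refine ⟨c + c' + b * a', a + a', b + b', ?_⟩
    change x.1 * y.1 = _
    rw [h, h', ← map_mul, pauli_mul]
  | inv x _ hx =>
    obtain ⟨c, a, b, h⟩ := hx
    refine ⟨c + a * b, a, b, ?_⟩
    change x.1ᵀ = _
    rw [h, ← pauli_transpose]
    rfl

theorem sigma1_mem : sigma1 ∈ E1 := Subgroup.subset_closure (by simp)

theorem sigma2_mem : sigma2 ∈ E1 := Subgroup.subset_closure (by simp)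

theorem sigma1_mul_sigma2 : sigma1Matrix * sigma2Matrix = -(sigma2Matrix * sigma1Matrix) := by
  rw [sigma1Matrix_eq, sigma2Matrix_eq, ← map_mul, ← map_mul, ← map_neg]
  congr 1
  decide

/-! ### Elements of `E(m)` -/

section E

variable {m : ℕ}

theorem tensorHom_mem_E {g : Fin m → Matrix.orthogonalGroup (ZMod 2) ℝ} (hg : ∀ i, g i ∈ E1) :
    tensorHom m g ∈ E m :=
  ⟨g, fun i _ => hg i, rfl⟩

theorem exists_pauli_of_mem_E {e : Matrix.orthogonalGroup (V m) ℝ} (he : e ∈ E m) :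
    ∃ c a b : V m, e.1 = iota.mapMatrix (tens fun i => pauli (c i) (a i) (b i)) := by
  obtain ⟨g, hg, rfl⟩ := he
  choose c a b h using fun i => exists_pauli_of_mem_E1 (hg i (Set.mem_univ i))
  refine ⟨c, a, b, ?_⟩
  rw [tens_map, ← funext h]
  rfl

/-- Entries of `tens` are products of entries, so the congruence can be read factor by factor in the
quotient by the ideal `(√2)`. -/
theorem tens_congr_one (K : Fin m → Matrix (ZMod 2) (ZMod 2) (ℤ√2)) :
    ∃ K', tens (fun i => 1 + (Zsqrtd.sqrtd : ℤ√2) • K i) = 1 + (Zsqrtd.sqrtd : ℤ√2) • K' := by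
  have h : ∀ v w : V m, (Zsqrtd.sqrtd : ℤ√2) ∣
      tens (fun i => 1 + (Zsqrtd.sqrtd : ℤ√2) • K i) v w - (1 : Matrix (V m) (V m) (ℤ√2)) v w := by
    intro v w
    have h1 : (1 : Matrix (V m) (V m) (ℤ√2)) = tens fun _ => 1 := by
      have := tens_smul_one (m := m) (1 : ℤ√2)
      simpa using this.symm
    rw [h1, ← Ideal.mem_span_singleton, ← Ideal.Quotient.mk_eq_mk_iff_sub_mem]
    simp only [tens, Matrix.of_apply, map_prod]
    refine Finset.prod_congr rfl fun i _ => ?_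
    rw [Ideal.Quotient.mk_eq_mk_iff_sub_mem, Ideal.mem_span_singleton]
    refine ⟨K i (v i) (w i), ?_⟩
    rw [Matrix.add_apply, add_sub_cancel_left]
    rfl
  choose K' hK' using h
  refine ⟨Matrix.of K', Matrix.ext fun v w => ?_⟩
  exact eq_add_of_sub_eq' (hK' v w)

/-- `E(m)` acts trivially on the lattice modulo `√2`. -/
theorem dvdEnd_one_of_mem_E {e : Matrix.orthogonalGroup (V m) ℝ} (he : e ∈ E m) :
    DvdEnd 1 (e.1 - 1) := by
  obtain ⟨c, a, b, h⟩ := exists_pauli_of_mem_E he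
  choose K hK using fun i => pauli_congr_one (c i) (a i) (b i)
  obtain ⟨K', hK'⟩ := tens_congr_one K
  refine ⟨K', ?_⟩
  have h1 : (tens fun i => pauli (c i) (a i) (b i)) * basisMatrix m =
      basisMatrix m * (1 + (Zsqrtd.sqrtd : ℤ√2) • K') := by
    rw [basisMatrix, ← hK', ← tens_mul, ← tens_mul]
    exact congrArg tens (funext hK)
  have h2 : iota.mapMatrix ((Zsqrtd.sqrtd : ℤ√2) • K') = √2 • iota.mapMatrix K' := by
    ext v w
    simp [iota_sqrtd]
  rw [Matrix.sub_mul, Matrix.one_mul, h, realBasis, ← map_mul, h1, map_mul, map_add, map_one, h2,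
    Matrix.mul_add, Matrix.mul_one, add_sub_cancel_left, Matrix.mul_smul, pow_one]

theorem DvdEnd.of_one_sub {h : Matrix (V m) (V m) ℝ} (hh : DvdEnd 1 (h - 1)) : DvdEnd 0 h := by
  obtain ⟨K, hK⟩ := hh
  refine ⟨1 + (Zsqrtd.sqrtd : ℤ√2) • K, ?_⟩
  have h2 : iota.mapMatrix ((Zsqrtd.sqrtd : ℤ√2) • K) = √2 • iota.mapMatrix K := by
    ext v w
    simp [iota_sqrtd]
  rw [Matrix.sub_mul, Matrix.one_mul, pow_one] at hK
  rw [map_add, map_one, h2, pow_zero, one_smul, Matrix.mul_add, Matrix.mul_one, Matrix.mul_smul,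
    ← hK, add_sub_cancel]

theorem E_le_orthogonalAut : E m ≤ orthogonalAut (M m) := fun _ he =>
  mem_orthogonalAut_of_dvdEnd (dvdEnd_one_of_mem_E he).of_one_sub
    (dvdEnd_one_of_mem_E (inv_mem he)).of_one_sub

/-- An element of `E(m)` fixes or negates each basis vector of the lattice, or maps it to an
orthogonal vector. -/
theorem E_trichotomy {e : Matrix.orthogonalGroup (V m) ℝ} (he : e ∈ E m) (u : V m) :
    (realBasis m)ᵀ u ⬝ᵥ (e.1 *ᵥ (realBasis m)ᵀ u) = 0 ∨
    e.1 *ᵥ (realBasis m)ᵀ u = (realBasis m)ᵀ u ∨ e.1 *ᵥ (realBasis m)ᵀ u = -(realBasis m)ᵀ u := by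
  obtain ⟨c, a, b, h⟩ := exists_pauli_of_mem_E he
  have h1 : ∀ v, (e.1 *ᵥ (realBasis m)ᵀ u) v =
      iota (tens (fun i => pauli (c i) (a i) (b i) * basisTwo) v u) := by
    intro v
    rw [tens_mul, h]
    change (iota.mapMatrix (tens fun i => pauli (c i) (a i) (b i)) * realBasis m) v u = _
    rw [realBasis, ← map_mul]
    rfl
  by_cases h0 : ∃ i, (basisTwoᵀ * (pauli (c i) (a i) (b i) * basisTwo)) (u i) (u i) = 0
  · left
    obtain ⟨i, hi⟩ := h0
    have h2 : (realBasis m)ᵀ u ⬝ᵥ (e.1 *ᵥ (realBasis m)ᵀ u) =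
        iota (tens (fun i => basisTwoᵀ * (pauli (c i) (a i) (b i) * basisTwo)) u u) := by
      rw [tens_mul, Matrix.mul_apply, map_sum, dotProduct]
      refine Finset.sum_congr rfl fun v _ => ?_
      rw [h1, map_mul]
      rfl
    rw [h2, tens, Matrix.of_apply, Finset.prod_eq_zero (Finset.mem_univ i) hi, map_zero]
  · right
    push Not at h0
    have h2 : ∀ i, ∃ ε : ℤ√2, (ε = 1 ∨ ε = -1) ∧
        ∀ j, (pauli (c i) (a i) (b i) * basisTwo) j (u i) = ε * basisTwo j (u i) := by
      intro i
      rcases (pauli_basisTwo (c i) (a i) (b i) (u i)).resolve_left (h0 i) with h | h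
      · exact ⟨1, Or.inl rfl, fun j => by rw [h, one_mul]⟩
      · exact ⟨-1, Or.inr rfl, fun j => by rw [h, neg_one_mul]⟩
    choose ε hε hp using h2
    have h3 : ∀ v, (e.1 *ᵥ (realBasis m)ᵀ u) v = iota (∏ i, ε i) * (realBasis m)ᵀ u v := by
      intro v
      rw [h1, tens, Matrix.of_apply, Finset.prod_congr rfl fun i _ => hp i (v i),
        Finset.prod_mul_distrib, map_mul]
      rfl
    have h4 : (∏ i, ε i) = 1 ∨ (∏ i, ε i) = -1 := by
      refine Finset.prod_induction ε (fun x => x = 1 ∨ x = -1) ?_ (Or.inl rfl) fun i _ => hε i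
      rintro _ _ (rfl | rfl) (rfl | rfl) <;> simp
    rcases h4 with h4 | h4
    · left
      ext v
      rw [h3, h4, map_one, one_mul]
    · right
      ext v
      rw [h3, h4, map_neg, map_one, neg_one_mul, Pi.neg_apply]

end E

/-! ### Clifford operations preserve the lattice -/

/-- For every basis vector `f` of the lattice, `f fᵀ` is the sum of an elementary abelian subgroup
of `E(m)`. -/
theorem exists_stabilizer {m : ℕ} (w : V m) : ∃ ρ : V m → Matrix.orthogonalGroup (V m) ℝ,
    (∀ a, ρ a ∈ E m) ∧ (∀ a b, ρ (a + b) = ρ a * ρ b) ∧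
    ∑ a, (ρ a).1 = Matrix.vecMulVec ((realBasis m)ᵀ w) ((realBasis m)ᵀ w) := by
  -- In one factor, `1 + σ₂ = diag(2, 0)` and `1 + σ₁`, the all-ones matrix, are `f fᵀ` for `f =
  -- (√2, 0)` and `f = (1, 1)`. Expanding the tensor product of such sums gives the subgroup.
  obtain ⟨τ, hτ⟩ : ∃ τ : ZMod 2 → Matrix.orthogonalGroup (ZMod 2) ℝ,
      τ = fun b => if b = 0 then sigma2 else sigma1 := ⟨_, rfl⟩
  have hτE : ∀ b, τ b ∈ E1 := fun b => by
    rw [hτ]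
    dsimp only
    split_ifs
    exacts [sigma2_mem, sigma1_mem]
  have hτP : ∀ b, (τ b).1 = iota.mapMatrix (pauli 0 b (1 + b)) := fun b => by
    have hb : b = 0 ∨ b = 1 := by revert b; decide
    rcases hb with rfl | rfl
    · rw [hτ]; exact sigma2Matrix_eq
    · rw [hτ]; exact sigma1Matrix_eq
  have hsq : ∀ b, τ b * τ b = 1 := fun b => by
    apply Subtype.ext
    change (τ b).1 * (τ b).1 = 1
    rw [hτP, ← map_mul, show pauli 0 b (1 + b) * pauli 0 b (1 + b) = 1 by revert b; decide, map_one]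
  obtain ⟨θ, hθ⟩ : ∃ θ : ZMod 2 → ZMod 2 → Matrix.orthogonalGroup (ZMod 2) ℝ,
      θ = fun b a => if a = 0 then 1 else τ b := ⟨_, rfl⟩
  have hθ0 : ∀ b, θ b 0 = 1 := fun b => by rw [hθ]; rfl
  have hθ1 : ∀ b, θ b 1 = τ b := fun b => by rw [hθ]; rfl
  have h2 : ∀ a : ZMod 2, a = 0 ∨ a = 1 := by decide
  refine ⟨fun a => tensorHom m fun i => θ (w i) (a i), fun a => tensorHom_mem_E fun i => ?_,
    fun a b => ?_, ?_⟩
  · rcases h2 (a i) with h | h <;> rw [h]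
    · rw [hθ0]; exact one_mem _
    · rw [hθ1]; exact hτE _
  · rw [← map_mul]
    refine congrArg (tensorHom m) (funext fun i => ?_)
    rw [Pi.mul_apply, Pi.add_apply]
    rcases h2 (a i) with h | h <;> rcases h2 (b i) with h' | h' <;> rw [h, h']
    · rw [add_zero, hθ0, one_mul]
    · rw [zero_add, hθ0, one_mul]
    · rw [add_zero, hθ0, mul_one]
    · rw [show (1 + 1 : ZMod 2) = 0 by decide, hθ0, hθ1, hsq]
  · have hsum : ∀ b i j : ZMod 2, (θ b 0).1 i j + (θ b 1).1 i j =
        iota (basisTwo i b * basisTwo j b) := by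
      intro b i j
      have e : (1 : Matrix (ZMod 2) (ZMod 2) ℝ) = iota.mapMatrix 1 := (map_one _).symm
      rw [hθ0, hθ1, hτP]
      change (1 : Matrix (ZMod 2) (ZMod 2) ℝ) i j + _ = _
      rw [e, RingHom.mapMatrix_apply, RingHom.mapMatrix_apply, Matrix.map_apply, Matrix.map_apply,
        ← map_add]
      congr 1
      revert b i j
      decide
    ext v u
    rw [Matrix.sum_apply, Matrix.vecMulVec_apply]
    change ∑ a : V m, ∏ i, (θ (w i) (a i)).1 (v i) (u i) =
      iota (∏ i, basisTwo (v i) (w i)) * iota (∏ i, basisTwo (u i) (w i))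
    rw [← map_mul, ← Finset.prod_mul_distrib, map_prod]
    refine (Fintype.prod_sum fun i a => (θ (w i) a).1 (v i) (u i)).symm.trans ?_
    refine Finset.prod_congr rfl fun i _ => ?_
    rw [← hsum]
    exact Fin.sum_univ_two _

/-- A sum of a real character over `F_2^m`, restricted to a subgroup, is `0` or a power of `2`. -/
theorem sum_dotProduct {m : ℕ} {ι : Type*} [Fintype ι] [DecidableEq ι]
    (ρ : V m → Matrix ι ι ℝ) (hρ : ∀ a b, ρ (a + b) = ρ a * ρ b) (h0 : ρ 0 = 1) (y : ι → ℝ)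
    (h : ∀ a, y ⬝ᵥ (ρ a *ᵥ y) = 0 ∨ ρ a *ᵥ y = y ∨ ρ a *ᵥ y = -y) :
    ∑ a, y ⬝ᵥ (ρ a *ᵥ y) = 0 ∨ ∃ j : ℕ, ∑ a, y ⬝ᵥ (ρ a *ᵥ y) = 2 ^ j * (y ⬝ᵥ y) := by
  classical
  by_cases hneg : ∃ b, ρ b *ᵥ y = -y
  · left
    obtain ⟨b, hb⟩ := hneg
    -- Translating the summation index by `b` negates every term.
    have h1 : ∑ a, y ⬝ᵥ (ρ a *ᵥ y) = -∑ a, y ⬝ᵥ (ρ a *ᵥ y) := by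
      conv_lhs => rw [← Equiv.sum_comp (Equiv.addRight b)]
      rw [← Finset.sum_neg_distrib]
      refine Finset.sum_congr rfl fun a _ => ?_
      rw [Equiv.coe_addRight, hρ, ← Matrix.mulVec_mulVec, hb, Matrix.mulVec_neg, dotProduct_neg]
    linarith
  · right
    push Not at hneg
    let T : AddSubgroup (V m) :=
      { carrier := {a | ρ a *ᵥ y = y}
        zero_mem' := by
          change ρ 0 *ᵥ y = y
          rw [h0, Matrix.one_mulVec]
        add_mem' := by
          intro a b ha hb
          change ρ (a + b) *ᵥ y = y
          rw [hρ, ← Matrix.mulVec_mulVec, show ρ b *ᵥ y = y from hb, show ρ a *ᵥ y = y from ha]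
        neg_mem' := by
          intro a ha
          have : -a = a := by
            funext i
            exact ZMod.neg_eq_self_mod_two (a i)
          change ρ (-a) *ᵥ y = y
          rw [this]
          exact ha }
    have hT : Nat.card T ∣ 2 ^ m := by
      have := AddSubgroup.card_addSubgroup_dvd_card T
      simpa using this
    obtain ⟨j, _, hj⟩ := (Nat.dvd_prime_pow Nat.prime_two).mp hT
    refine ⟨j, ?_⟩
    -- Only the stabilizer `T` of `y` contributes, and its order is a power of `2`.
    have h1 : ∀ a, y ⬝ᵥ (ρ a *ᵥ y) = if a ∈ T then y ⬝ᵥ y else 0 := by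
      intro a
      split_ifs with ha
      · rw [show ρ a *ᵥ y = y from ha]
      · exact (h a).resolve_right (not_or.mpr ⟨ha, hneg a⟩)
    have h3 : Nat.card T = (Finset.univ.filter fun a => a ∈ T).card := by
      rw [Nat.card_eq_fintype_card]
      exact Fintype.card_subtype _
    rw [Finset.sum_congr rfl fun a _ => h1 a, ← Finset.sum_filter, Finset.sum_const, nsmul_eq_mul,
      ← h3, hj, Nat.cast_pow, Nat.cast_ofNat]

theorem realBasis_norm {m : ℕ} (u : V m) : (realBasis m)ᵀ u ⬝ᵥ (realBasis m)ᵀ u = 2 ^ m := by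
  have h := congrArg iota (gram_diag m u)
  rw [Matrix.mul_apply, map_sum, map_pow, map_ofNat] at h
  rw [← h]
  refine Finset.sum_congr rfl fun v _ => ?_
  rw [map_mul]
  rfl

theorem dvdEnd_zero_of_mem_cliffordGroup {m : ℕ} {n : Matrix.orthogonalGroup (V m) ℝ}
    (hn : n ∈ cliffordGroup m) : DvdEnd 0 n.1 := by
  have key : ∀ w, n.1 *ᵥ (realBasis m)ᵀ w ∈ basisLattice m := by
    intro w
    refine mem_basisLattice_of_dotProduct fun u => ?_
    obtain ⟨f, hf⟩ : ∃ f, f = (realBasis m)ᵀ w := ⟨_, rfl⟩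
    obtain ⟨y, hy⟩ : ∃ y, y = (realBasis m)ᵀ u := ⟨_, rfl⟩
    rw [← hf, ← hy]
    obtain ⟨ρ, hρE, hρ, hsum⟩ := exists_stabilizer w
    -- The square is `yᵀ n (f fᵀ) nᵀ y`, with `f fᵀ` replaced by the sum of the `ρ a`.
    have hsq : (y ⬝ᵥ (n.1 *ᵥ f)) ^ 2 = ∑ a, y ⬝ᵥ ((n * ρ a * n⁻¹).1 *ᵥ y) := by
      have e1 : ∑ a, (n * ρ a * n⁻¹).1 = Matrix.vecMulVec (n.1 *ᵥ f) (n.1 *ᵥ f) := by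
        change ∑ a, n.1 * (ρ a).1 * n.1ᵀ = _
        rw [← Finset.sum_mul, ← Finset.mul_sum, hsum, ← hf, Matrix.mul_vecMulVec,
          Matrix.vecMulVec_mul, Matrix.vecMul_transpose]
      rw [← dotProduct_sum, ← Matrix.sum_mulVec, e1, Matrix.vecMulVec_mulVec, op_smul_eq_smul,
        dotProduct_smul, smul_eq_mul, pow_two, dotProduct_comm (n.1 *ᵥ f) y]
    have hρ0 : ρ 0 = 1 := by
      have := hρ 0 0
      rwa [add_zero, left_eq_mul] at this
    have hs := sum_dotProduct (fun a => (n * ρ a * n⁻¹).1)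
      (fun a b => by
        change (n * ρ (a + b) * n⁻¹).1 = ((n * ρ a * n⁻¹) * (n * ρ b * n⁻¹)).1
        rw [hρ]
        congr 1
        group)
      (by
        change (n * ρ 0 * n⁻¹).1 = (1 : Matrix.orthogonalGroup (V m) ℝ).1
        rw [hρ0, mul_one, mul_inv_cancel]) y
      (fun a => by
        rw [hy]
        exact E_trichotomy ((Subgroup.mem_normalizer_iff.mp hn _).mp (hρE a)) u)
    rw [← hsq] at hs
    rcases hs with hs | ⟨j, hs⟩
    · exact ⟨0, by rw [pow_eq_zero_iff (by norm_num)] at hs; rw [hs, map_zero, mul_zero]⟩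
    · have h1 : (y ⬝ᵥ (n.1 *ᵥ f)) ^ 2 = (√2 ^ m * √2 ^ j) ^ 2 := by
        rw [hs, hy, realBasis_norm, mul_pow, ← pow_mul, ← pow_mul, two_pow_eq, two_pow_eq]
        ring
      rcases sq_eq_sq_iff_eq_or_eq_neg.mp h1 with h | h
      · exact ⟨Zsqrtd.sqrtd ^ j, by rw [h, iota_sqrtd_pow]⟩
      · exact ⟨-Zsqrtd.sqrtd ^ j, by rw [h, map_neg, iota_sqrtd_pow, mul_neg]⟩
  choose c hc using key
  refine ⟨(Matrix.of c)ᵀ, ?_⟩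
  rw [pow_zero, one_smul]
  ext v w
  exact congrFun (hc w) v

theorem cliffordGroup_le_orthogonalAut (m : ℕ) : cliffordGroup m ≤ orthogonalAut (M m) :=
  fun _ hn => mem_orthogonalAut_of_dvdEnd (dvdEnd_zero_of_mem_cliffordGroup hn)
    (dvdEnd_zero_of_mem_cliffordGroup (inv_mem hn))

/-! ### The commutant of `E(m)` -/

section commutant

variable {m : ℕ}

/-- The tensor product of `A` in position `i` with identity matrices elsewhere. -/
def site (i : Fin m) (A : Matrix.orthogonalGroup (ZMod 2) ℝ) : Matrix.orthogonalGroup (V m) ℝ :=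
  tensorHom m (Pi.mulSingle i A)

theorem site_mem_E (i : Fin m) {A : Matrix.orthogonalGroup (ZMod 2) ℝ} (hA : A ∈ E1) :
    site i A ∈ E m := tensorHom_mem_E fun j => by
  rcases eq_or_ne j i with rfl | h
  · rwa [Pi.mulSingle_eq_same]
  · rw [Pi.mulSingle_eq_of_ne h]; exact one_mem _

theorem site_apply (i : Fin m) (A : Matrix.orthogonalGroup (ZMod 2) ℝ) (v w : V m) :
    (site i A).1 v w = if ∀ j, j ≠ i → v j = w j then A.1 (v i) (w i) else 0 := by
  change ∏ j, ((Pi.mulSingle i A : Fin m → Matrix.orthogonalGroup (ZMod 2) ℝ) j).1 (v j) (w j) = _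
  have h1 : ∀ j, j ≠ i →
      ((Pi.mulSingle i A : Fin m → Matrix.orthogonalGroup (ZMod 2) ℝ) j).1 (v j) (w j) =
        (1 : Matrix (ZMod 2) (ZMod 2) ℝ) (v j) (w j) := fun j hj => by
    rw [Pi.mulSingle_eq_of_ne hj]; rfl
  split_ifs with h
  · rw [Finset.prod_eq_single i, Pi.mulSingle_eq_same]
    · intro j _ hj
      rw [h1 j hj, h j hj, Matrix.one_apply_eq]
    · intro hi
      exact absurd (Finset.mem_univ i) hi
  · push Not at h
    obtain ⟨j, hj, hvw⟩ := h
    exact Finset.prod_eq_zero (Finset.mem_univ j) (by rw [h1 j hj, Matrix.one_apply_ne hvw])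

theorem site_sigma1_apply (i : Fin m) (v w : V m) :
    (site i sigma1).1 v w = if w = v + Pi.single i 1 then 1 else 0 := by
  have h2 : ∀ a b : ZMod 2, (¬ a = b) ↔ b = a + 1 := by decide
  have h : w = v + Pi.single i 1 ↔ (∀ j, j ≠ i → v j = w j) ∧ ¬ v i = w i := by
    rw [h2]
    constructor
    · rintro rfl
      refine ⟨fun j hj => ?_, ?_⟩
      · rw [Pi.add_apply, Pi.single_eq_of_ne hj, add_zero]
      · rw [Pi.add_apply, Pi.single_eq_same]
    · rintro ⟨h, hi⟩
      funext j
      rcases eq_or_ne j i with rfl | hj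
      · rw [Pi.add_apply, Pi.single_eq_same, hi]
      · rw [Pi.add_apply, Pi.single_eq_of_ne hj, add_zero, h j hj]
  rw [site_apply]
  simp only [h, ite_and]
  refine if_congr Iff.rfl ?_ rfl
  simp [sigma1, sigma1Matrix]

theorem site_sigma2_eq (i : Fin m) :
    (site i sigma2).1 = Matrix.diagonal fun v => if v i = 0 then (1 : ℝ) else -1 := by
  ext v w
  rw [site_apply, Matrix.diagonal_apply]
  have h : v = w ↔ (∀ j, j ≠ i → v j = w j) ∧ v i = w i := by
    constructor
    · rintro rfl
      simp
    · rintro ⟨h, hi⟩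
      funext j
      rcases eq_or_ne j i with rfl | hj
      · exact hi
      · exact h j hj
  simp only [h, ite_and]
  refine if_congr Iff.rfl ?_ rfl
  change sigma2Matrix (v i) (w i) = _
  rw [sigma2Matrix, Matrix.diagonal_apply]

theorem eq_of_translation_invariant {α : Type*} {φ : V m → α}
    (h : ∀ i v, φ (v + Pi.single i 1) = φ v) (v : V m) : φ v = φ 0 := by
  have h2 : ∀ a : ZMod 2, a = 0 ∨ a = 1 := by decide
  have key : ∀ s : Finset (Fin m), φ (∑ i ∈ s, Pi.single i (v i)) = φ 0 := by
    intro s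
    induction s using Finset.induction_on with
    | empty => simp
    | insert i s hi ih =>
      rw [Finset.sum_insert hi, add_comm]
      rcases h2 (v i) with hv | hv <;> rw [hv]
      · rw [Pi.single_zero, add_zero, ih]
      · rw [h, ih]
  have := key Finset.univ
  rwa [Finset.univ_sum_single] at this

/-- `E(m)` is absolutely irreducible. -/
theorem eq_smul_one_of_commute {h : Matrix (V m) (V m) ℝ}
    (h1 : ∀ i, Commute h (site i sigma1).1) (h2 : ∀ i, Commute h (site i sigma2).1) :
    h = h 0 0 • 1 := by
  -- The diagonal sign matrices separate the basis vectors, forcing `h` to be diagonal; the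
  -- translations then make its diagonal constant.
  have hdiag : ∀ v w, v ≠ w → h v w = 0 := by
    intro v w hvw
    obtain ⟨i, hi⟩ := Function.ne_iff.mp hvw
    have e := congrFun (congrFun (h2 i).eq v) w
    rw [site_sigma2_eq, Matrix.mul_diagonal, Matrix.diagonal_mul] at e
    have h3 : ∀ a : ZMod 2, a = 0 ∨ a = 1 := by decide
    rcases h3 (v i) with hv | hv <;> rcases h3 (w i) with hw | hw
    · exact absurd (hv.trans hw.symm) hi
    · rw [hv, hw, if_pos rfl, if_neg one_ne_zero] at e
      linarith
    · rw [hv, hw, if_pos rfl, if_neg one_ne_zero] at e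
      linarith
    · exact absurd (hv.trans hw.symm) hi
  have hconst : ∀ i v, h (v + Pi.single i 1) (v + Pi.single i 1) = h v v := by
    intro i v
    have e := congrFun (congrFun (h1 i).eq v) (v + Pi.single i 1)
    rw [Matrix.mul_apply, Matrix.mul_apply] at e
    simp only [site_sigma1_apply, add_left_inj, mul_ite, mul_one, mul_zero, ite_mul, one_mul,
      zero_mul, Finset.sum_ite_eq, Finset.sum_ite_eq', Finset.mem_univ, if_true] at e
    exact e.symm
  ext v w
  rcases eq_or_ne v w with rfl | hvw
  · rw [Matrix.smul_apply, Matrix.one_apply_eq, smul_eq_mul, mul_one]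
    exact eq_of_translation_invariant (φ := fun v => h v v) hconst v
  · rw [hdiag v w hvw, Matrix.smul_apply, Matrix.one_apply_ne hvw, smul_zero]

theorem eq_one_or_neg_one_of_commute {h : Matrix.orthogonalGroup (V m) ℝ}
    (h1 : ∀ i, Commute h (site i sigma1)) (h2 : ∀ i, Commute h (site i sigma2)) :
    h.1 = 1 ∨ h.1 = -1 := by
  have e := eq_smul_one_of_commute (fun i => congrArg Subtype.val (h1 i).eq)
    (fun i => congrArg Subtype.val (h2 i).eq)
  have ho := (Matrix.mem_orthogonalGroup_iff (V m) ℝ).mp h.2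
  change h.1 * h.1ᵀ = 1 at ho
  rw [e, Matrix.transpose_smul, Matrix.transpose_one, Matrix.smul_mul, Matrix.mul_smul, smul_smul,
    Matrix.one_mul] at ho
  have hc := congrFun (congrFun ho 0) 0
  rw [Matrix.smul_apply, Matrix.one_apply_eq, smul_eq_mul, mul_one] at hc
  rcases mul_self_eq_one_iff.mp hc with h | h
  · left
    rw [e, h, one_smul]
  · right
    rw [e, h, neg_smul, one_smul]

end commutant

/-! ### Lattice automorphisms normalize `E(m)` -/

section normalize

variable {m : ℕ}

theorem tensorMatrix_smul (ε : Fin m → ℝ) (A : Fin m → Matrix (ZMod 2) (ZMod 2) ℝ) :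
    tensorMatrix (fun i => ε i • A i) = (∏ i, ε i) • tensorMatrix A := by
  ext v w
  simp [tensorMatrix, Finset.prod_mul_distrib]

/-- `-1` is `(σ₁σ₂)²` placed in a single tensor factor, so at least one factor is needed. -/
theorem neg_mem_E (hm : 1 ≤ m) {e g : Matrix.orthogonalGroup (V m) ℝ} (he : e ∈ E m)
    (hg : g.1 = -e.1) : g ∈ E m := by
  obtain ⟨i₀⟩ : Nonempty (Fin m) := ⟨⟨0, hm⟩⟩
  have h : site i₀ ((sigma1 * sigma2) ^ 2) ∈ E m :=
    site_mem_E i₀ (pow_mem (mul_mem sigma1_mem sigma2_mem) 2)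
  have h1 : (site i₀ ((sigma1 * sigma2) ^ 2)).1 = -1 := by
    have hsq : ((sigma1 * sigma2) ^ 2).1 = -1 := by
      rw [pow_two]
      change sigma1Matrix * sigma2Matrix * (sigma1Matrix * sigma2Matrix) = -1
      rw [sigma1Matrix_eq, sigma2Matrix_eq]
      simp only [← map_mul]
      rw [← map_one iota.mapMatrix, ← map_neg]
      congr 1
      decide
    have e : (site i₀ ((sigma1 * sigma2) ^ 2)).1 =
        tensorMatrix fun j => (if j = i₀ then (-1 : ℝ) else 1) • (1 : Matrix _ _ ℝ) := by
      change tensorMatrix (fun j => _) = _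
      congr 1
      funext j
      rcases eq_or_ne j i₀ with rfl | hj
      · rw [Pi.mulSingle_eq_same, hsq, if_pos rfl, neg_smul, one_smul]
      · rw [Pi.mulSingle_eq_of_ne hj, if_neg hj, one_smul]
        rfl
    rw [e, tensorMatrix_smul, tensorMatrix_one]
    simp
  have : g = site i₀ ((sigma1 * sigma2) ^ 2) * e := by
    apply Subtype.ext
    change g.1 = (site i₀ ((sigma1 * sigma2) ^ 2)).1 * e.1
    rw [hg, h1, neg_one_mul]
  rw [this]
  exact mul_mem h he

/-- If `A i` commutes with `B` up to the sign `ε`, so do the matrices on the tensor product. -/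
theorem tensorHom_mul_site {A : Fin m → Matrix.orthogonalGroup (ZMod 2) ℝ}
    {B : Matrix.orthogonalGroup (ZMod 2) ℝ} {i : Fin m} {ε : ℝ}
    (h : (A i).1 * B.1 = ε • (B.1 * (A i).1)) :
    (tensorHom m A).1 * (site i B).1 = ε • ((site i B).1 * (tensorHom m A).1) := by
  have e : (tensorHom m A * site i B).1 = tensorMatrix fun j => (if j = i then ε else 1) •
      (((Pi.mulSingle i B : Fin m → Matrix.orthogonalGroup (ZMod 2) ℝ) * A) j).1 := by
    rw [site, ← map_mul]
    change tensorMatrix (fun j => _) = _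
    congr 1
    funext j
    rw [Pi.mul_apply, Pi.mul_apply]
    rcases eq_or_ne j i with rfl | hj
    · rw [Pi.mulSingle_eq_same, if_pos rfl]
      exact h
    · rw [Pi.mulSingle_eq_of_ne hj, if_neg hj, one_smul, mul_one, one_mul]
  change (tensorHom m A * site i B).1 = ε • (site i B * tensorHom m A).1
  rw [e, tensorMatrix_smul, Finset.prod_ite_eq' Finset.univ i, if_pos (Finset.mem_univ i), site,
    ← map_mul]
  rfl

/-- As `σ₁` and `σ₂` anticommute, the four sign patterns are realized by `1`, `σ₁`, `σ₂` and `σ₁σ₂`.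
-/
theorem exists_sign_E1 {ε δ : ℝ} (hε : ε = 1 ∨ ε = -1) (hδ : δ = 1 ∨ δ = -1) : ∃ A ∈ E1,
    A.1 * sigma1.1 = ε • (sigma1.1 * A.1) ∧ A.1 * sigma2.1 = δ • (sigma2.1 * A.1) := by
  have h : sigma1.1 * sigma2.1 = -(sigma2.1 * sigma1.1) := sigma1_mul_sigma2
  have h' : sigma2.1 * sigma1.1 = -(sigma1.1 * sigma2.1) := by rw [h, neg_neg]
  rcases hε with rfl | rfl <;> rcases hδ with rfl | rfl
  · exact ⟨1, one_mem _, by simp, by simp⟩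
  · exact ⟨sigma1, sigma1_mem, by simp, by rw [h, neg_one_smul]⟩
  · exact ⟨sigma2, sigma2_mem, by rw [h', neg_one_smul], by simp⟩
  · refine ⟨sigma1 * sigma2, mul_mem sigma1_mem sigma2_mem, ?_, ?_⟩
    · change sigma1.1 * sigma2.1 * sigma1.1 = (-1 : ℝ) • (sigma1.1 * (sigma1.1 * sigma2.1))
      rw [Matrix.mul_assoc, h', Matrix.mul_neg, neg_one_smul]
    · change sigma1.1 * sigma2.1 * sigma2.1 = (-1 : ℝ) • (sigma2.1 * (sigma1.1 * sigma2.1))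
      rw [← Matrix.mul_assoc, h', neg_mul, neg_one_smul, neg_neg]

/-- If `e` and `g` commute with `x` up to the same sign, then `e⁻¹ g` commutes with `x`. -/
theorem commute_inv_mul {e g x : Matrix.orthogonalGroup (V m) ℝ} {ε : ℝ}
    (he : e.1 * x.1 = ε • (x.1 * e.1)) (hg : g.1 * x.1 = ε • (x.1 * g.1)) :
    Commute (e⁻¹ * g) x := by
  refine mul_left_cancel (a := e) ?_
  apply Subtype.ext
  have h1 : e * (e⁻¹ * g * x) = g * x := by group
  have h2 : (e * (x * (e⁻¹ * g))).1 = ε • (x * g).1 := by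
    change e.1 * (x.1 * (e⁻¹ * g).1) = ε • (x.1 * g.1)
    rw [← Matrix.mul_assoc, he, Matrix.smul_mul, Matrix.mul_assoc]
    congr 2
    change (e * (e⁻¹ * g)).1 = g.1
    rw [mul_inv_cancel_left]
  rw [h1, h2]
  exact hg

/-- An isometry which commutes up to signs with the generators of `E(m)` lies in `E(m)`. -/
theorem mem_E_of_commute_up_to_sign (hm : 1 ≤ m) {g : Matrix.orthogonalGroup (V m) ℝ}
    (h : ∀ A ∈ E1, ∀ i, ∃ ε : ℝ, (ε = 1 ∨ ε = -1) ∧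
      g.1 * (site i A).1 = ε • ((site i A).1 * g.1)) : g ∈ E m := by
  choose ε hε h1 using h sigma1 sigma1_mem
  choose δ hδ h2 using h sigma2 sigma2_mem
  choose A hA hA1 hA2 using fun i => exists_sign_E1 (hε i) (hδ i)
  have hc := eq_one_or_neg_one_of_commute (h := (tensorHom m A)⁻¹ * g)
    (fun i => commute_inv_mul (tensorHom_mul_site (hA1 i)) (h1 i))
    (fun i => commute_inv_mul (tensorHom_mul_site (hA2 i)) (h2 i))
  have hg : g.1 = (tensorHom m A).1 * ((tensorHom m A)⁻¹ * g).1 := by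
    change g.1 = (tensorHom m A * ((tensorHom m A)⁻¹ * g)).1
    rw [mul_inv_cancel_left]
  rcases hc with hc | hc
  · rw [hc, mul_one] at hg
    rw [Subtype.ext hg]
    exact tensorHom_mem_E hA
  · rw [hc, mul_neg_one] at hg
    exact neg_mem_E hm (tensorHom_mem_E hA) hg

/-- Congruence levels add because `x y x⁻¹ y⁻¹ - 1` is the ring commutator of `x - 1` and `y - 1`,
times the lattice automorphism `x⁻¹ y⁻¹`. -/
theorem dvdEnd_commutator {k l : ℕ} {x y : Matrix.orthogonalGroup (V m) ℝ}
    (hx : x ∈ orthogonalAut (M m)) (hy : y ∈ orthogonalAut (M m))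
    (hxk : DvdEnd k (x.1 - 1)) (hyl : DvdEnd l (y.1 - 1)) :
    DvdEnd (k + l) ((x * y * x⁻¹ * y⁻¹).1 - 1) := by
  have e : (x * y * x⁻¹ * y⁻¹).1 - 1 =
      ((x.1 - 1) * (y.1 - 1) - (y.1 - 1) * (x.1 - 1)) * (x⁻¹ * y⁻¹).1 := by
    have e1 : (x.1 - 1) * (y.1 - 1) - (y.1 - 1) * (x.1 - 1) = (x * y).1 - (y * x).1 := by
      change _ = x.1 * y.1 - y.1 * x.1
      noncomm_ring
    rw [e1, Matrix.sub_mul]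
    congr 1
    · change _ = (x * y * (x⁻¹ * y⁻¹)).1
      rw [mul_assoc (x * y)]
    · change (1 : Matrix.orthogonalGroup (V m) ℝ).1 = (y * x * (x⁻¹ * y⁻¹)).1
      congr 1
      group
  have hyx := hyl.mul hxk
  rw [add_comm l k] at hyx
  rw [e]
  exact DvdEnd.mul (l := 0) ((hxk.mul hyl).sub hyx)
    (dvdEnd_of_mem_orthogonalAut (mul_mem (inv_mem hx) (inv_mem hy)))

/-- Lattice automorphisms which are congruent to the identity modulo `√2` lie in `E(m)`. -/
theorem mem_E_of_dvdEnd_one (hm : 1 ≤ m) {g : Matrix.orthogonalGroup (V m) ℝ}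
    (hg : g ∈ orthogonalAut (M m)) (h : DvdEnd 1 (g.1 - 1)) : g ∈ E m := by
  refine mem_E_of_commute_up_to_sign hm fun A hA i => ?_
  have hx : site i A ∈ E m := site_mem_E i hA
  obtain ⟨x, hxd⟩ : ∃ x, x = site i A := ⟨_, rfl⟩
  rw [← hxd] at hx ⊢
  have hxM := E_le_orthogonalAut hx
  obtain ⟨c, hc⟩ : ∃ c, c = g * x * g⁻¹ * x⁻¹ := ⟨_, rfl⟩
  have hcM : c ∈ orthogonalAut (M m) := by
    rw [hc]
    exact mul_mem (mul_mem (mul_mem hg hxM) (inv_mem hg)) (inv_mem hxM)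
  have hc2 : DvdEnd 2 (c.1 - 1) := by
    rw [hc]
    exact dvdEnd_commutator hg hxM h (dvdEnd_one_of_mem_E hx)
  -- A second commutator with `E m` raises the level from `2` to `3`, where only the identity is
  -- left.
  have hcomm : ∀ y ∈ E m, Commute c y := by
    intro y hy
    have h3 := eq_one_of_dvdEnd_three (c * y * c⁻¹ * y⁻¹).2
      (dvdEnd_commutator hcM (E_le_orthogonalAut hy) hc2 (dvdEnd_one_of_mem_E hy))
    have h4 : c * y * c⁻¹ * y⁻¹ = 1 := Subtype.ext h3
    rw [mul_inv_eq_one, mul_inv_eq_iff_eq_mul] at h4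
    exact h4
  have hgx : g * x = c * (x * g) := by
    rw [hc]
    group
  have hgx' : g.1 * x.1 = c.1 * (x.1 * g.1) := congrArg Subtype.val hgx
  rcases eq_one_or_neg_one_of_commute (fun i => hcomm _ (site_mem_E i sigma1_mem))
    (fun i => hcomm _ (site_mem_E i sigma2_mem)) with h1 | h1
  · exact ⟨1, Or.inl rfl, by rw [hgx', h1, one_mul, one_smul]⟩
  · exact ⟨-1, Or.inr rfl, by rw [hgx', h1, neg_one_mul, neg_one_smul]⟩

/-- Being `1` modulo `√2` survives conjugation by lattice automorphisms, since `n e n⁻¹ - 1 = n (e -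
1) n⁻¹`. -/
theorem conj_mem_E (hm : 1 ≤ m) {n e : Matrix.orthogonalGroup (V m) ℝ}
    (hn : n ∈ orthogonalAut (M m)) (he : e ∈ E m) : n * e * n⁻¹ ∈ E m := by
  refine mem_E_of_dvdEnd_one hm (mul_mem (mul_mem hn (E_le_orthogonalAut he)) (inv_mem hn)) ?_
  have h : (n * e * n⁻¹).1 - 1 = n.1 * (e.1 - 1) * (n⁻¹).1 := by
    have h1 : n.1 * (n⁻¹).1 = 1 := congrArg Subtype.val (mul_inv_cancel n)
    rw [Matrix.mul_sub, Matrix.sub_mul, Matrix.mul_one, h1]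
    rfl
  rw [h]
  exact ((dvdEnd_of_mem_orthogonalAut hn).mul (dvdEnd_one_of_mem_E he)).mul
    (dvdEnd_of_mem_orthogonalAut (inv_mem hn))

theorem orthogonalAut_le_cliffordGroup (hm : 1 ≤ m) : orthogonalAut (M m) ≤ cliffordGroup m := by
  intro n hn
  refine Subgroup.mem_normalizer_iff.mpr fun e => ⟨conj_mem_E hm hn, fun he => ?_⟩
  have h := conj_mem_E hm (inv_mem hn) he
  have e1 : n⁻¹ * (n * e * n⁻¹) * n⁻¹⁻¹ = e := by group
  rwa [e1] at h

end normalize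

end BarnesWall

theorem mainTheorem6 (m : ℕ) (hm : 1 ≤ m) :
    BarnesWall.orthogonalAut (BarnesWall.M m) = BarnesWall.cliffordGroup m :=
  le_antisymm (BarnesWall.orthogonalAut_le_cliffordGroup hm)
    (BarnesWall.cliffordGroup_le_orthogonalAut m)
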